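/- **Theorem 4.1.** *Notation.* Let $n\ge 1$ and let $\mathcal H$ be a complex Hilbert space. For ${\bf p}=(p_1,\dots,p_n)\in\mathbb Z_+^n$ put $|{\bf p}|=p_1+\dots+p_n$, ${\bf p}!=p_1!\cdots p_n!$ and $T^{\bf p}=T_1^{p_1}\cdots T_n^{p_n}$. Let $\mathbb F_n^+$ be the free semigroup with identity on generators $g_1,\dots,g_n$; for $\alpha=g_{i_1}\cdots g_{i_k}$ put $T_\alpha=T_{i_1}\cdots T_{i_k}$ (the identity if $k=0$). Let $\mathbb B_n$ be the open unit ball of $\mathbb C^n$ and $\Lambda_{\bf p}=\{\alpha\in\mathbb F_n^+:\lambda_\alpha=\lambda^{\bf p}\text{ for all }\lambda\in\mathbb B_n\}$. Let $F^2=\bigoplus_{k\ge0}(\mathbb C^n)^{\otimes k}$ be the full Fock space over $\mathbb C^n$, $S_i\varphi=e_i\otimes\varphi$ the left creation operators on it, $F_s^2\subset F^2$ the symmetric Fock space, and $B_i=P_{F_s^2}S_i|_{F_s^2}$ the creation operators on $F_s^2$. All tensor products are Hilbert space tensor products, and infinite series of operators converge in the operator norm. Let $f(\lambda)=\sum_{{\bf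 p}\in\mathbb Z_+^n}\lambda^{\bf p}A_{({\bf p})}$, with $A_{({\bf p})}\in B(\mathcal H)$, be an operator-valued analytic function on $\mathbb B_n$ such that $$\limsup_{k\to\infty}\Big\|\sum_{|{\bf p}|=k}\frac{|{\bf p}|!}{{\bf p}!}A_{({\bf p})}^*A_{({\bf p})}\Big\|^{1/2k}\le 1,$$ $f(0)\ge0$, and $\operatorname{Re} f_{\rm sym}(rS_1,\dots,rS_n)\le I$ for $0\le r<1$, where $$f_{\rm sym}(rS_1,\dots,rS_n)=\sum_{k=0}^\infty\ \sum_{|{\bf p}|=k}\Big(\frac{{\bf p}!}{|{\bf p}|!}\sum_{\alpha\in\Lambda_{\bf p}}r^{|{\bf p}|}S_\alpha\Big)\otimes A_{({\bf p})}.$$ Then: (i) $\Big\|\sum_{|{\bf p}|=k}\frac{{\bf p}!}{|{\bf p}|!}A_{({\bf p})}^*A_{({\bf p})}\Big\|^{1/2}\le 2\|I-A_{(0)}\|$ for $k=1,2,\dots$. (ii) $\sum_{k=0}^\infty r^k\Big\|\sum_{|{\bf p}|=k}\frac{{\bf p}!}{|{\bf p}|!}A_{({\bf p})}^*A_{({\bf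 p})}\Big\|^{1/2}\le\|A_{(0)}\|+\|I-A_{(0)}\|$ for $0\le r\le\frac13$. (iii) If $\mathcal K$ is a complex Hilbert space and $Y_{({\bf p})}\in B(\mathcal K)$, ${\bf p}\in\mathbb Z_+^n$, satisfy $\|Y_{(0)}\|\le1$ and $\sum_{k=1}^\infty\Big\|\sum_{|{\bf p}|=k}\frac{|{\bf p}|!}{{\bf p}!}Y_{({\bf p})}^*Y_{({\bf p})}\Big\|^{1/2}\le\frac12$, then $$\Big\|\sum_{k=0}^\infty\Big(\sum_{|{\bf p}|=k}B^{\bf p}\otimes A_{({\bf p})}\otimes Y_{({\bf p})}\Big)\Big\|\le1,$$ and in particular $\Big\|\sum_{k=0}^\infty\Big(\sum_{|{\bf p}|=k}\lambda^{\bf p}A_{({\bf p})}\otimes Y_{({\bf p})}\Big)\Big\|\le1$ for every $\lambda\in\mathbb B_n$; both series converge in the operator norm. (iv) If $Y_1,\dots,Y_n$ are commuting bounded operators on a complex Hilbert space $\mathcal K$ and the row operator $[Y_1^*,\dots,Y_n^*]:\mathcal K^n\to\mathcal K$ has norm at most $\frac13$, then $\Big\|\sum_{k=0}^\infty\Big(\sum_{|{\bf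 p}|=k}B^{\bf p}\otimes Y^{\bf p}\otimes A_{({\bf p})}\Big)\Big\|\le1$, the series converging in the operator norm. (v) If $T_1,\dots,T_n$ are commuting bounded operators on a complex Hilbert space $\mathcal K$ with $\|T_1T_1^*+\dots+T_nT_n^*\|^{1/2}\le\frac13$, then $\sum_{k=0}^\infty\Big\|\sum_{|{\bf p}|=k}T^{\bf p}\otimes A_{({\bf p})}\Big\|\le\|A_{(0)}\|+\|I-A_{(0)}\|$. -/

import Mathlib

open scoped TensorProduct ENNReal Nat ComplexStarModule
open Filter

noncomputable section

namespace BohrFock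

/-! ### Multi-indices -/

/-- The set `{p ∈ ℤ₊ⁿ : |p| = k}` of multi-indices of degree `k`. -/
def multiIdx (n k : ℕ) : Finset (Fin n → ℕ) := Finset.piAntidiag Finset.univ k

/-- The number `|p|! / p!`, where `|p| = p₁ + ⋯ + pₙ` and `p! = p₁! ⋯ pₙ!`. -/
def multiCoef {n : ℕ} (p : Fin n → ℕ) : ℝ := ((∑ i, p i)! : ℝ) / ((∏ i, (p i)! : ℕ) : ℝ)

/-- The monomial `λ^p = λ₁^{p₁} ⋯ λₙ^{pₙ}` at a point of `ℂⁿ`. -/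
def monomialAt {n : ℕ} (z : EuclideanSpace ℂ (Fin n)) (p : Fin n → ℕ) : ℂ := ∏ i, z i ^ p i

/-- The ordered product `T^p = T₁^{p₁} T₂^{p₂} ⋯ Tₙ^{pₙ}`. -/
def tuplePow {M : Type*} [Monoid M] {n : ℕ} (T : Fin n → M) (p : Fin n → ℕ) : M :=
  (List.ofFn fun i => T i ^ p i).prod

/-! ### The free semigroup and the classes `Λ_p` -/

/-- For a word `α = g_{i₁} ⋯ g_{iₖ}` this is `T_α = T_{i₁} ⋯ T_{iₖ}` (the identity if `α` is the
empty word). -/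
def wordProd {M : Type*} [Monoid M] {n : ℕ} (T : Fin n → M) (α : FreeMonoid (Fin n)) : M :=
  FreeMonoid.lift T α

/-- The set `Λ_p` of the words `α` such that `λ_α = λ^p` for all `λ` in the open unit ball
of `ℂⁿ`. -/
def wordClass {n : ℕ} (p : Fin n → ℕ) : Set (FreeMonoid (Fin n)) :=
  {α | ∀ z ∈ Metric.ball (0 : EuclideanSpace ℂ (Fin n)) 1,
    wordProd (fun i => z i) α = monomialAt z p}

theorem wordProd_const {n : ℕ} (c : ℂ) (α : FreeMonoid (Fin n)) :
    wordProd (fun _ => c) α = c ^ α.length := by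
  induction α using FreeMonoid.inductionOn' with
  | one => simp [wordProd]
  | of_mul i β ih =>
    simp only [wordProd] at ih ⊢
    rw [map_mul, ih, FreeMonoid.lift_eval_of, FreeMonoid.length_mul, FreeMonoid.length_of, pow_add,
      pow_one]

theorem length_of_mem_wordClass {n : ℕ} {p : Fin n → ℕ} {α : FreeMonoid (Fin n)}
    (h : α ∈ wordClass p) : α.length = ∑ i, p i := by
  have hpos : (0 : ℝ) < (n : ℝ) + 2 := by positivity
  set c : ℝ := ((n : ℝ) + 2)⁻¹ with hc
  have hc0 : 0 < c := by positivity
  have hc1 : c < 1 := inv_lt_one_of_one_lt₀ (by linarith [(Nat.cast_nonneg n : (0 : ℝ) ≤ n)])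
  have hz := h (WithLp.toLp 2 fun _ => (c : ℂ)) (by
    rw [mem_ball_zero_iff, EuclideanSpace.norm_eq, Real.sqrt_lt' one_pos]
    simp only [Complex.norm_real, Real.norm_eq_abs, sq_abs, Finset.sum_const, Finset.card_univ,
      Fintype.card_fin, nsmul_eq_mul, one_pow]
    have h1 : ((n : ℝ) + 2) * c = 1 := by rw [hc]; field_simp
    nlinarith)
  have e : (c : ℂ) ^ α.length = (c : ℂ) ^ (∑ i, p i) := by
    rw [← wordProd_const, ← Finset.prod_pow_eq_pow_sum]
    simpa [monomialAt] using hz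
  have e' : c ^ α.length = c ^ (∑ i, p i) := by exact_mod_cast e
  exact (pow_right_injective₀ hc0 hc1.ne) e'

theorem wordClass_finite {n : ℕ} (p : Fin n → ℕ) : (wordClass p).Finite :=
  (List.finite_length_eq (Fin n) (∑ i, p i)).subset fun _ h => length_of_mem_wordClass h

/-! ### The full Fock space and the left creation operators -/

/-- The full Fock space `F²(Hₙ) = ⨁ₖ Hₙ^{⊗k}` of `Hₙ = ℂⁿ`, in coordinates with respect to its
orthonormal basis `e_α = e_{i₁} ⊗ ⋯ ⊗ e_{iₖ}`, `α = g_{i₁} ⋯ g_{iₖ}` (the vacuum vector if `α` is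
the empty word). -/
abbrev Fock (n : ℕ) : Type := lp (fun _ : FreeMonoid (Fin n) => ℂ) 2

/-- Coordinates of `e_i ⊗ u`: the value at `g_i β` is `u β`, and the value at any word that does
not start with `g_i` is `0`. -/
def shiftFun {n : ℕ} (i : Fin n) (u : FreeMonoid (Fin n) → ℂ) : FreeMonoid (Fin n) → ℂ :=
  Function.extend (fun β => FreeMonoid.of i * β) u 0

theorem of_mul_injective {n : ℕ} (i : Fin n) :
    Function.Injective fun β : FreeMonoid (Fin n) => FreeMonoid.of i * β :=
  fun _ _ h => List.cons_injective h

theorem shiftFun_of_mul {n : ℕ} (i : Fin n) (u : FreeMonoid (Fin n) → ℂ)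
    (β : FreeMonoid (Fin n)) : shiftFun i u (FreeMonoid.of i * β) = u β :=
  (of_mul_injective i).extend_apply u 0 β

theorem shiftFun_of_not_exists {n : ℕ} {i : Fin n} {u : FreeMonoid (Fin n) → ℂ}
    {α : FreeMonoid (Fin n)} (h : ¬∃ β, FreeMonoid.of i * β = α) : shiftFun i u α = 0 := by
  simp [shiftFun, Function.extend_apply' _ _ _ h]

theorem norm_shiftFun {n : ℕ} (i : Fin n) (u : FreeMonoid (Fin n) → ℂ) :
    (fun α => ‖shiftFun i u α‖ ^ (2 : ℝ)) =
      Function.extend (fun β => FreeMonoid.of i * β) (fun β => ‖u β‖ ^ (2 : ℝ)) 0 := by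
  funext α
  by_cases h : ∃ β, FreeMonoid.of i * β = α
  · obtain ⟨β, rfl⟩ := h
    have e1 := (of_mul_injective i).extend_apply u 0 β
    have e2 := (of_mul_injective i).extend_apply (fun β => ‖u β‖ ^ (2 : ℝ)) 0 β
    simp only [shiftFun]
    exact (congrArg (fun x : ℂ => ‖x‖ ^ (2 : ℝ)) e1).trans e2.symm
  · simp [shiftFun, Function.extend_apply' _ _ _ h]

/-- The left creation operator `S_i u = e_i ⊗ u`, as an isometry. -/
def creationIsometry {n : ℕ} (i : Fin n) : Fock n →ₗᵢ[ℂ] Fock n where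
  toFun u := ⟨shiftFun i u, by
    have h := (lp.memℓp u).summable (by norm_num)
    refine memℓp_gen ?_
    have h2 : (2 : ℝ≥0∞).toReal = (2 : ℝ) := by norm_num
    rw [h2] at h ⊢
    rw [norm_shiftFun]
    exact ((hasSum_extend_zero (of_mul_injective i)).2 h.hasSum).summable⟩
  map_add' u v := by
    ext α
    change shiftFun i (u + v) α = shiftFun i u α + shiftFun i v α
    by_cases h : ∃ β, FreeMonoid.of i * β = α
    · obtain ⟨β, rfl⟩ := h
      simp only [shiftFun_of_mul, Pi.add_apply]
    · simp only [shiftFun_of_not_exists h, add_zero]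
  map_smul' c u := by
    ext α
    change shiftFun i (c • u) α = c * shiftFun i u α
    by_cases h : ∃ β, FreeMonoid.of i * β = α
    · obtain ⟨β, rfl⟩ := h
      simp only [shiftFun_of_mul, Pi.smul_apply, smul_eq_mul]
    · simp only [shiftFun_of_not_exists h, mul_zero]
  norm_map' u := by
    have h : Summable fun β => ‖u β‖ ^ (2 : ℝ) := by
      simpa using (lp.memℓp u).summable (by norm_num)
    have key : ∑' α, ‖shiftFun i u α‖ ^ (2 : ℝ) = ∑' β, ‖u β‖ ^ (2 : ℝ) := by
      rw [norm_shiftFun]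
      exact ((hasSum_extend_zero (of_mul_injective i)).2 h.hasSum).tsum_eq
    rw [lp.norm_eq_tsum_rpow (by norm_num), lp.norm_eq_tsum_rpow (by norm_num)]
    have h2 : (2 : ℝ≥0∞).toReal = (2 : ℝ) := by norm_num
    simp only [h2]
    exact congrArg (fun x : ℝ => x ^ (1 / (2 : ℝ))) key

/-- The left creation operator `S_i` on the full Fock space. -/
def leftCreation {n : ℕ} (i : Fin n) : Fock n →L[ℂ] Fock n :=
  (creationIsometry i).toContinuousLinearMap

/-! ### The symmetric Fock space -/

/-- The symmetric Fock space `F_s²(Hₙ) ⊆ F²(Hₙ)`: the vectors whose coordinates are invariant under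
permutations of the letters of a word. -/
def symFock (n : ℕ) : Submodule ℂ (Fock n) where
  carrier := {u | ∀ α β : FreeMonoid (Fin n), α.toList.Perm β.toList → u α = u β}
  add_mem' h₁ h₂ α β hp := by simp [h₁ α β hp, h₂ α β hp]
  zero_mem' α β _ := by simp
  smul_mem' c u h α β hp := by simp [h α β hp]

theorem isClosed_symFock (n : ℕ) : IsClosed (symFock n : Set (Fock n)) := by
  have h : (symFock n : Set (Fock n)) =
      ⋂ (α : FreeMonoid (Fin n)) (β : FreeMonoid (Fin n)) (_ : α.toList.Perm β.toList),
        {u : Fock n | u α = u β} := by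
    ext u
    simp only [Set.mem_iInter]
    rfl
  rw [h]
  refine isClosed_iInter fun α => isClosed_iInter fun β => isClosed_iInter fun _ => ?_
  exact isClosed_eq (lp.evalCLM ℂ (fun _ : FreeMonoid (Fin n) => ℂ) 2 α).continuous
    (lp.evalCLM ℂ (fun _ : FreeMonoid (Fin n) => ℂ) 2 β).continuous

instance instCompleteSpaceSymFock (n : ℕ) : CompleteSpace (symFock n) :=
  (isClosed_symFock n).completeSpace_coe

/-- The creation operator `B_i = P_{F_s²} S_i |_{F_s²}` on the symmetric Fock space. -/
def symCreation {n : ℕ} (i : Fin n) : symFock n →L[ℂ] symFock n :=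
  (symFock n).orthogonalProjectionOnto ∘L leftCreation i ∘L (symFock n).subtypeL

/-! ### Hilbert space tensor products -/

section Tensor

variable (E F : Type*) [NormedAddCommGroup E] [InnerProductSpace ℂ E]
  [NormedAddCommGroup F] [InnerProductSpace ℂ F]

/-- The Hilbert space tensor product: the completion of the algebraic tensor product, normed by
`⟪a ⊗ b, c ⊗ d⟫ = ⟪a, c⟫ ⟪b, d⟫`. -/
def HTensor : Type _ := UniformSpace.Completion (E ⊗[ℂ] F)

instance instNormedAddCommGroupHTensor : NormedAddCommGroup (HTensor E F) :=
  inferInstanceAs (NormedAddCommGroup (UniformSpace.Completion (E ⊗[ℂ] F)))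

instance instInnerProductSpaceHTensor : InnerProductSpace ℂ (HTensor E F) :=
  inferInstanceAs (InnerProductSpace ℂ (UniformSpace.Completion (E ⊗[ℂ] F)))

instance instCompleteSpaceHTensor : CompleteSpace (HTensor E F) :=
  inferInstanceAs (CompleteSpace (UniformSpace.Completion (E ⊗[ℂ] F)))

variable {E F}

/-- The operator `T ⊗ A` on the Hilbert space tensor product. -/
def opTensor (T : E →L[ℂ] E) (A : F →L[ℂ] F) : HTensor E F →L[ℂ] HTensor E F :=
  (TensorProduct.mapL T A).completion

end Tensor

/-- The row operator `[T₁, …, Tₙ] : Kⁿ → K`, `(x₁, …, xₙ) ↦ T₁ x₁ + ⋯ + Tₙ xₙ`, where `Kⁿ` is the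
Hilbert space direct sum. -/
def rowOp {K : Type*} [NormedAddCommGroup K] [InnerProductSpace ℂ K] {n : ℕ}
    (T : Fin n → K →L[ℂ] K) : PiLp 2 (fun _ : Fin n => K) →L[ℂ] K :=
  ∑ i, T i ∘L PiLp.proj 2 (fun _ : Fin n => K) i

/-! ### The symmetrized functional calculus -/

section Calculus

variable {n : ℕ} {E H : Type*}
  [NormedAddCommGroup E] [InnerProductSpace ℂ E] [NormedAddCommGroup H] [InnerProductSpace ℂ H]

/-- `(λ^p)_sym(X₁, …, Xₙ) = (p! / |p|!) ∑_{α ∈ Λ_p} X_α`. -/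
def symMonomial (X : Fin n → E →L[ℂ] E) (p : Fin n → ℕ) : E →L[ℂ] E :=
  (((multiCoef p)⁻¹ : ℝ) : ℂ) • ∑ α ∈ (wordClass_finite p).toFinset, wordProd X α

/-- `f_sym(X₁, …, Xₙ) = ∑ₖ ∑_{|p| = k} (λ^p)_sym(X₁, …, Xₙ) ⊗ A_p` for the power series
`f = ∑ₚ λ^p A_p`. -/
def symCalculus (A : (Fin n → ℕ) → H →L[ℂ] H) (X : Fin n → E →L[ℂ] E) :
    HTensor E H →L[ℂ] HTensor E H :=
  ∑' k : ℕ, ∑ p ∈ multiIdx n k, opTensor (symMonomial X p) (A p)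

end Calculus

end BohrFock

end

open BohrFock

/-
Cauchy estimates make the series `f_sym(rS)` converge absolutely by degree for `r < 1`. Pairing
`Re f_sym(rS) ≤ I` with the vectors `v_0 ⊗ x + ∑_{|p| = k} v_p ⊗ w_p`, where `v_p` is the sum of the
basis vectors `e_α`, `α ∈ Λ_p`, isolates the terms of degree `0` and `k`. Letting `r → 1` and
optimizing over the `w_p`, which have the form `R y_p` when `x = R ξ`, gives
`∑_{|p| = k} (p! / |p|!) (R A_p R)⋆ (R A_p R) ≤ 4` for every self-adjoint `R` with
`R (I - A_0) R ≤ I`. Taking `R` to be a multiple of the identity yields (i), and (ii) follows by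
summing a geometric series.

For (iii) take `R = s⁻¹` with `s² = I - A_0 + ε`. Then `A_p = s C_p s`, where the `C_p` of degree
`k` form a column of norm at most `2`, and the series becomes `√A_0 Y_0 √A_0 + s G s` with
`‖G‖ ≤ 2 · (1 / 2)`. Its norm is at most `‖A_0 + s²‖ = 1 + ε`. The Fock space and scalar versions
of (iii) and the statement (iv) are the same estimate in different commuting representations;
it only uses that the `B^p` of degree `k`, with weights `|p|! / p!`, form a row contraction.
-/

noncomputable section

namespace BohrFock

section Words

variable {n k : ℕ} {p : Fin n → ℕ}

theorem mem_multiIdx : p ∈ multiIdx n k ↔ ∑ i, p i = k := by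
  simp [multiIdx, Finset.mem_piAntidiag]

theorem multiIdx_zero (n : ℕ) : multiIdx n 0 = {0} := by
  simp [multiIdx]

theorem monomialAt_smul (t : ℂ) (z : EuclideanSpace ℂ (Fin n)) (p : Fin n → ℕ) :
    monomialAt (t • z) p = t ^ (∑ i, p i) * monomialAt z p := by
  simp only [monomialAt, PiLp.smul_apply, smul_eq_mul, mul_pow, Finset.prod_mul_distrib,
    Finset.prod_pow_eq_pow_sum]

/-- The multi-index of a word, counting the occurrences of each generator. -/
def content (α : FreeMonoid (Fin n)) : Fin n → ℕ := fun i => α.toList.count i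

theorem sum_content (α : FreeMonoid (Fin n)) : ∑ i, content α i = α.length := by
  simpa only [content, FreeMonoid.length, Multiset.coe_count, Multiset.coe_card] using
    Multiset.sum_count_eq_card fun i (_ : i ∈ (α.toList : Multiset (Fin n))) => Finset.mem_univ i

theorem wordProd_one {M : Type*} [Monoid M] (T : Fin n → M) : wordProd T 1 = 1 :=
  map_one _

theorem wordProd_of_mul {M : Type*} [Monoid M] (T : Fin n → M) (i : Fin n)
    (α : FreeMonoid (Fin n)) : wordProd T (FreeMonoid.of i * α) = T i * wordProd T α := by
  simp [wordProd]

theorem wordProd_eq_prod_pow_content {M : Type*} [CommMonoid M] (z : Fin n → M)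
    (α : FreeMonoid (Fin n)) : wordProd z α = ∏ i, z i ^ content α i := by
  rw [wordProd, FreeMonoid.lift_apply, Finset.prod_list_map_count]
  exact Finset.prod_subset (Finset.subset_univ _) fun i _ hi => by
    rw [List.count_eq_zero_of_not_mem (by simpa using hi), pow_zero]

theorem wordProd_eq_monomialAt_content (z : EuclideanSpace ℂ (Fin n)) (α : FreeMonoid (Fin n)) :
    wordProd (fun i => z i) α = monomialAt z (content α) :=
  wordProd_eq_prod_pow_content _ _

theorem mem_wordClass_iff {α : FreeMonoid (Fin n)} : α ∈ wordClass p ↔ content α = p := by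
  refine ⟨fun h => ?_, fun h z _ => h ▸ wordProd_eq_monomialAt_content z α⟩
  -- The two monomials have the same degree, so their equality extends from the ball to `ℂⁿ`.
  have hlen : ∑ i, content α i = ∑ i, p i := (sum_content α).trans (length_of_mem_wordClass h)
  have heq : ∀ w : EuclideanSpace ℂ (Fin n), monomialAt w (content α) = monomialAt w p := by
    intro w
    set t : ℝ := (‖w‖ + 1)⁻¹
    have ht : 0 < t := by positivity
    have hw : (t : ℂ) • w ∈ Metric.ball (0 : EuclideanSpace ℂ (Fin n)) 1 := by
      rw [mem_ball_zero_iff, norm_smul, Complex.norm_of_nonneg ht.le,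
        inv_mul_lt_one₀ (by positivity)]
      exact lt_add_one _
    have := h _ hw
    rw [wordProd_eq_monomialAt_content, monomialAt_smul, monomialAt_smul, hlen] at this
    exact mul_left_cancel₀ (pow_ne_zero _ (by exact_mod_cast ht.ne')) this
  funext i
  have h2 : ∀ q : Fin n → ℕ,
      monomialAt (WithLp.toLp 2 (Function.update 1 i 2)) q = 2 ^ q i := fun q => by
    rw [monomialAt, Finset.prod_eq_single i] <;> simp +contextual [Function.update_of_ne]
  have := heq (WithLp.toLp 2 (Function.update 1 i 2))
  rw [h2, h2] at this
  exact Nat.pow_right_injective le_rfl (by exact_mod_cast this)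

/-- The class `Λ_p` as a finite set. -/
def wordFin (p : Fin n → ℕ) : Finset (FreeMonoid (Fin n)) := (wordClass_finite p).toFinset

theorem mem_wordFin {α : FreeMonoid (Fin n)} : α ∈ wordFin p ↔ content α = p := by
  rw [wordFin, Set.Finite.mem_toFinset, mem_wordClass_iff]

theorem wordFin_zero : wordFin (0 : Fin n → ℕ) = {1} := by
  ext α
  rw [mem_wordFin, Finset.mem_singleton, ← FreeMonoid.length_eq_zero, ← sum_content,
    Finset.sum_eq_zero_iff]
  simp [funext_iff]

/-- The finite set of the words of length `k`. -/
def words (n k : ℕ) : Finset (FreeMonoid (Fin n)) := (List.finite_length_eq (Fin n) k).toFinset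

theorem mem_words {α : FreeMonoid (Fin n)} : α ∈ words n k ↔ α.length = k :=
  Set.Finite.mem_toFinset _

theorem words_zero (n : ℕ) : words n 0 = {1} := by
  ext α
  rw [mem_words, FreeMonoid.length_eq_zero, Finset.mem_singleton]

theorem sum_words_succ {M : Type*} [AddCommMonoid M] (F : FreeMonoid (Fin n) → M) :
    ∑ α ∈ words n (k + 1), F α = ∑ i, ∑ α ∈ words n k, F (FreeMonoid.of i * α) := by
  rw [← Finset.sum_product']
  symm
  refine Finset.sum_nbij (fun x => FreeMonoid.of x.1 * x.2) (fun x hx => ?_) (fun x _ y _ h => ?_)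
    (fun α hα => ?_) (fun _ _ => rfl)
  · rw [mem_words, FreeMonoid.length_mul, FreeMonoid.length_of,
      mem_words.1 (Finset.mem_product.1 hx).2, add_comm]
  · exact Prod.ext_iff.2 (List.cons.inj h)
  · obtain ⟨i, β, hα'⟩ := List.exists_cons_of_length_eq_add_one (mem_words.1 hα)
    refine ⟨(i, β), Finset.mem_product.2 ⟨Finset.mem_univ i, mem_words.2 ?_⟩, hα'.symm⟩
    exact Nat.succ.inj ((congrArg List.length hα').symm.trans (mem_words.1 hα))

theorem sum_multiIdx_sum_wordFin {M : Type*} [AddCommMonoid M] (F : FreeMonoid (Fin n) → M) :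
    ∑ p ∈ multiIdx n k, ∑ α ∈ wordFin p, F α = ∑ α ∈ words n k, F α := by
  rw [← Finset.sum_fiberwise_of_maps_to (g := content) (t := multiIdx n k)
    (fun α hα => by rw [mem_multiIdx, sum_content, mem_words.1 hα])]
  refine Finset.sum_congr rfl fun p hp => Finset.sum_congr ?_ fun _ _ => rfl
  ext α
  rw [mem_wordFin, Finset.mem_filter, mem_words, ← sum_content]
  exact ⟨fun h => ⟨by rw [h, mem_multiIdx.1 hp], h⟩, And.right⟩

theorem sum_words_wordProd {R : Type*} [Semiring R] (x : Fin n → R) (k : ℕ) :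
    ∑ α ∈ words n k, wordProd x α = (∑ i, x i) ^ k := by
  induction k with
  | zero => rw [words_zero, Finset.sum_singleton, wordProd_one, pow_zero]
  | succ k ih => simp only [sum_words_succ, wordProd_of_mul, ← Finset.mul_sum, ih,
      ← Finset.sum_mul, pow_succ']

theorem card_wordFin_eq_multinomial (p : Fin n → ℕ) :
    (wordFin p).card = Nat.multinomial Finset.univ p := by
  -- Compare the coefficients of `X^p` in two expansions of `(X₁ + ⋯ + Xₙ)^|p|`.
  let X : Fin n → MvPolynomial (Fin n) ℕ := MvPolynomial.X
  have hX : ∀ q : Fin n → ℕ, ∏ i, X i ^ q i =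
      MvPolynomial.monomial (Finsupp.equivFunOnFinite.symm q) 1 := fun q => by
    rw [MvPolynomial.monomial_eq, Finsupp.prod_fintype _ _ (by simp)]
    simp [X]
  have hcard : ∀ q : Fin n → ℕ, ∑ α ∈ wordFin q, wordProd X α =
      (wordFin q).card • MvPolynomial.monomial (Finsupp.equivFunOnFinite.symm q) 1 := fun q => by
    rw [← Finset.sum_const]
    refine Finset.sum_congr rfl fun α hα => ?_
    rw [wordProd_eq_prod_pow_content, mem_wordFin.1 hα, hX]
  have hsum := sum_words_wordProd X (∑ i, p i)
  rw [Finset.sum_pow_eq_sum_piAntidiag, ← sum_multiIdx_sum_wordFin] at hsum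
  have hcoeff := congrArg (MvPolynomial.coeff (Finsupp.equivFunOnFinite.symm p)) hsum
  simpa [hcard, hX, MvPolynomial.coeff_sum, ← nsmul_eq_mul, MvPolynomial.coeff_monomial,
    multiIdx] using hcoeff

theorem multiCoef_eq_multinomial (p : Fin n → ℕ) :
    multiCoef p = Nat.multinomial Finset.univ p := by
  have hfact : ∏ i, (p i)! ≠ 0 := Finset.prod_ne_zero_iff.2 fun i _ => Nat.factorial_ne_zero (p i)
  rw [multiCoef, div_eq_iff (by exact_mod_cast hfact), mul_comm]
  exact_mod_cast (Nat.multinomial_spec Finset.univ p).symm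

theorem card_wordFin (p : Fin n → ℕ) : ((wordFin p).card : ℝ) = multiCoef p := by
  rw [card_wordFin_eq_multinomial, multiCoef_eq_multinomial]

theorem one_le_multiCoef (p : Fin n → ℕ) : 1 ≤ multiCoef p := by
  rw [multiCoef_eq_multinomial]
  exact_mod_cast Nat.multinomial_pos _ _

theorem multiCoef_pos (p : Fin n → ℕ) : 0 < multiCoef p :=
  one_pos.trans_le (one_le_multiCoef p)

theorem inv_multiCoef_nonneg (p : Fin n → ℕ) : 0 ≤ multiCoef⁻¹ p :=
  inv_nonneg.2 (multiCoef_pos p).le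

theorem multiCoef_zero : multiCoef (0 : Fin n → ℕ) = 1 := by
  simp [multiCoef]

end Words

section TuplePow

variable {M N : Type*} [Monoid M] [Monoid N] {n : ℕ} {T : Fin n → M} {p : Fin n → ℕ}

theorem tuplePow_zero (T : Fin n → M) : tuplePow T 0 = 1 := by
  simp [tuplePow, List.ofFn_const]

theorem map_tuplePow {F : Type*} [FunLike F M N] [MonoidHomClass F M N] (θ : F) (T : Fin n → M)
    (p : Fin n → ℕ) : θ (tuplePow T p) = tuplePow (fun i => θ (T i)) p := by
  simp only [tuplePow, map_list_prod, List.map_ofFn, Function.comp_def, map_pow]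

theorem commute_tuplePow {a : M} (h : ∀ i, Commute a (T i)) (p : Fin n → ℕ) :
    Commute a (tuplePow T p) := by
  refine Commute.list_prod_right _ _ fun b hb => ?_
  obtain ⟨i, rfl⟩ := (List.mem_ofFn' _ _).1 hb
  exact (h i).pow_right _

theorem wordProd_tuplePow_of (T : Fin n → M) (p : Fin n → ℕ) :
    wordProd T (tuplePow FreeMonoid.of p) = tuplePow T p := by
  simp only [wordProd, map_tuplePow, FreeMonoid.lift_eval_of]

theorem content_tuplePow_of (p : Fin n → ℕ) : content (tuplePow FreeMonoid.of p) = p := by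
  refine mem_wordClass_iff.1 fun z _ => ?_
  rw [wordProd_tuplePow_of, tuplePow, List.prod_ofFn, monomialAt]

theorem wordProd_eq_of_content_eq (h : ∀ i j, Commute (T i) (T j)) {α β : FreeMonoid (Fin n)}
    (hαβ : content α = content β) : wordProd T α = wordProd T β := by
  have hperm : α.toList.Perm β.toList := List.perm_iff_count.2 (congrFun hαβ)
  rw [wordProd, wordProd, FreeMonoid.lift_apply, FreeMonoid.lift_apply]
  exact (hperm.map T).prod_eq' (List.pairwise_map.2 (List.pairwise_of_forall fun i j => h i j))

theorem star_wordProd [StarMul M] (T : Fin n → M) (α : FreeMonoid (Fin n)) :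
    star (wordProd T α) = wordProd (fun i => star (T i)) α.reverse := by
  induction α using FreeMonoid.inductionOn' with
  | one => rw [wordProd_one, star_one]; exact (wordProd_one _).symm
  | of_mul i β ih =>
    rw [wordProd_of_mul, star_mul, ih, FreeMonoid.reverse_mul, FreeMonoid.reverse_of, wordProd,
      wordProd, map_mul, FreeMonoid.lift_eval_of]

theorem content_reverse (α : FreeMonoid (Fin n)) : content α.reverse = content α :=
  funext fun _ => List.count_reverse

end TuplePow

section WordMean

variable {R : Type*} [Ring R] [Module ℝ R] {n : ℕ} {T : Fin n → R}

/-- The symmetrized monomial `(λ^p)_sym(T) = (p! / |p|!) ∑_{α ∈ Λ_p} T_α`, which is the mean of the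
`T_α` over the words `α` of content `p`; this is `symMonomial` in an arbitrary real algebra. -/
def wordMean (T : Fin n → R) (p : Fin n → ℕ) : R :=
  (multiCoef p)⁻¹ • ∑ α ∈ wordFin p, wordProd T α

theorem wordMean_zero (T : Fin n → R) : wordMean T 0 = 1 := by
  rw [wordMean, wordFin_zero, Finset.sum_singleton, wordProd_one, multiCoef_zero, inv_one, one_smul]

theorem wordMean_eq_tuplePow (h : ∀ i j, Commute (T i) (T j)) (p : Fin n → ℕ) :
    wordMean T p = tuplePow T p := by
  have hconst : ∀ α ∈ wordFin p, wordProd T α = tuplePow T p := fun α hα => by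
    rw [← wordProd_tuplePow_of,
      wordProd_eq_of_content_eq h ((mem_wordFin.1 hα).trans (content_tuplePow_of p).symm)]
  rw [wordMean, Finset.sum_congr rfl hconst, Finset.sum_const, ← Nat.cast_smul_eq_nsmul ℝ,
    card_wordFin, inv_smul_smul₀ (multiCoef_pos p).ne']

theorem star_wordMean [StarRing R] [StarModule ℝ R] (T : Fin n → R) (p : Fin n → ℕ) :
    star (wordMean T p) = wordMean (fun i => star (T i)) p := by
  have hrev : ∀ α ∈ wordFin p, α.reverse ∈ wordFin p := fun α hα =>
    mem_wordFin.2 ((content_reverse α).trans (mem_wordFin.1 hα))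
  rw [wordMean, star_smul, star_trivial, star_sum, wordMean]
  exact congrArg _ (Finset.sum_nbij' FreeMonoid.reverse FreeMonoid.reverse hrev hrev
    (fun _ _ => FreeMonoid.reverse_reverse) (fun _ _ => FreeMonoid.reverse_reverse)
    fun α _ => star_wordProd T α)

end WordMean

theorem symMonomial_eq_wordMean {E : Type*} [NormedAddCommGroup E] [InnerProductSpace ℂ E] {n : ℕ}
    (X : Fin n → E →L[ℂ] E) (p : Fin n → ℕ) : symMonomial X p = wordMean X p :=
  Complex.coe_smul _ _

theorem symMonomial_apply {E : Type*} [NormedAddCommGroup E] [InnerProductSpace ℂ E] {n : ℕ}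
    (X : Fin n → E →L[ℂ] E) (p : Fin n → ℕ) (u : E) :
    symMonomial X p u = ((multiCoef p)⁻¹ : ℂ) • ∑ α ∈ wordFin p, wordProd X α u := by
  rw [symMonomial, smul_apply, sum_apply, Complex.ofReal_inv]
  rfl

theorem symMonomial_smul {E : Type*} [NormedAddCommGroup E] [InnerProductSpace ℂ E] {n : ℕ}
    (c : ℂ) (X : Fin n → E →L[ℂ] E) (p : Fin n → ℕ) :
    symMonomial (fun i => c • X i) p = c ^ (∑ i, p i) • symMonomial X p := by
  have hword : ∀ α : FreeMonoid (Fin n),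
      wordProd (fun i => c • X i) α = c ^ α.length • wordProd X α := fun α => by
    induction α using FreeMonoid.inductionOn' with
    | one => simp [wordProd_one]
    | of_mul i β ih =>
      rw [wordProd_of_mul, ih, wordProd_of_mul, FreeMonoid.length_mul, FreeMonoid.length_of,
        smul_mul_smul_comm, pow_add, pow_one]
  have hsum : ∑ α ∈ (wordClass_finite p).toFinset, wordProd (fun i => c • X i) α =
      c ^ (∑ i, p i) • ∑ α ∈ (wordClass_finite p).toFinset, wordProd X α := by
    rw [Finset.smul_sum]
    refine Finset.sum_congr rfl fun α hα => ?_
    rw [hword, length_of_mem_wordClass ((wordClass_finite p).mem_toFinset.1 hα)]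
  rw [symMonomial, hsum, smul_comm, symMonomial]

section CStar

variable {ι L L' : Type*} [CStarAlgebra L] [CStarAlgebra L']

/-- The norm of the weighted column with entries `√(w i) a i`, `i ∈ s`, over a C⋆-algebra. -/
def colNorm (s : Finset ι) (w : ι → ℝ) (a : ι → L) : ℝ :=
  √‖∑ i ∈ s, w i • (star (a i) * a i)‖

theorem colNorm_nonneg (s : Finset ι) (w : ι → ℝ) (a : ι → L) : 0 ≤ colNorm s w a :=
  Real.sqrt_nonneg _

theorem colNorm_smul (s : Finset ι) (w : ι → ℝ) (t : ℝ) (a : ι → L) :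
    colNorm s w (fun i => t • a i) = |t| * colNorm s w a := by
  have h : ∀ i, w i • (star (t • a i) * (t • a i)) = (t * t) • w i • (star (a i) * a i) :=
    fun i => by
      simp only [star_smul, star_trivial, smul_mul_assoc, mul_smul_comm, smul_smul, mul_comm]
  rw [colNorm, Finset.sum_congr rfl fun i _ => h i, ← Finset.smul_sum, norm_smul,
    Real.sqrt_mul (norm_nonneg _), Real.norm_of_nonneg (mul_self_nonneg t),
    Real.sqrt_mul_self_eq_abs, colNorm]

theorem sq_colNorm_le_sum (s : Finset ι) {w : ι → ℝ} (hw : ∀ i, 0 ≤ w i) (a : ι → L) :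
    colNorm s w a ^ 2 ≤ ∑ i ∈ s, w i * ‖a i‖ ^ 2 := by
  rw [colNorm, Real.sq_sqrt (norm_nonneg _)]
  refine (norm_sum_le _ _).trans (Finset.sum_le_sum fun i _ => ?_)
  rw [norm_smul, CStarRing.norm_star_mul_self, Real.norm_of_nonneg (hw i), sq]

theorem starAlgHom_map_real_smul (θ : L →⋆ₐ[ℂ] L') (t : ℝ) (x : L) : θ (t • x) = t • θ x :=
  LinearMap.map_smul_of_tower (θ : L →ₗ[ℂ] L') t x

theorem colNorm_map_le (θ : L →⋆ₐ[ℂ] L') (s : Finset ι) (w : ι → ℝ) (a : ι → L) :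
    colNorm s w (fun i => θ (a i)) ≤ colNorm s w a := by
  have h : ∑ i ∈ s, w i • (star (θ (a i)) * θ (a i)) = θ (∑ i ∈ s, w i • (star (a i) * a i)) := by
    simp only [map_sum, starAlgHom_map_real_smul, map_mul, map_star]
  rw [colNorm, h]
  exact Real.sqrt_le_sqrt (NonUnitalStarAlgHom.norm_apply_le θ _)

variable [PartialOrder L] [StarOrderedRing L] {s : Finset ι} {w w' : ι → ℝ} {a b : ι → L} {c : ℝ}

theorem norm_le_iff_le_smul_one {x : L} (hx : 0 ≤ x) (hc : 0 ≤ c) : ‖x‖ ≤ c ↔ x ≤ c • (1 : L) := by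
  rw [CStarAlgebra.norm_le_iff_le_algebraMap x hc hx, Algebra.algebraMap_eq_smul_one]

theorem sum_smul_star_mul_self_nonneg (hw : ∀ i, 0 ≤ w i) :
    0 ≤ ∑ i ∈ s, w i • (star (a i) * a i) :=
  Finset.sum_nonneg fun i _ => smul_nonneg (hw i) (star_mul_self_nonneg _)

theorem colNorm_le_iff (hw : ∀ i, 0 ≤ w i) (hc : 0 ≤ c) :
    colNorm s w a ≤ c ↔ ∑ i ∈ s, w i • (star (a i) * a i) ≤ c ^ 2 • (1 : L) := by
  rw [colNorm, Real.sqrt_le_left hc,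
    norm_le_iff_le_smul_one (sum_smul_star_mul_self_nonneg hw) (sq_nonneg c)]

theorem colNorm_one_le_one_iff :
    colNorm s 1 a ≤ 1 ↔ ∑ i ∈ s, star (a i) * a i ≤ (1 : L) := by
  simpa using colNorm_le_iff (s := s) (a := a) (w := 1) (fun _ => zero_le_one) zero_le_one

theorem colNorm_mono (hw : ∀ i, 0 ≤ w i) (hww' : ∀ i, w i ≤ w' i) :
    colNorm s w a ≤ colNorm s w' a :=
  Real.sqrt_le_sqrt <| CStarAlgebra.norm_le_norm_of_nonneg_of_le
    (sum_smul_star_mul_self_nonneg hw) <|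
    Finset.sum_le_sum fun i _ => smul_le_smul_of_nonneg_right (hww' i) (star_mul_self_nonneg _)

theorem colNorm_mul_le (hw : ∀ i, 0 ≤ w i) :
    colNorm s w (fun i => a i * b i) ≤ colNorm s w a * colNorm s 1 b := by
  set c := colNorm s w a
  have ha : ∀ i ∈ s, w i • (star (a i) * a i) ≤ c ^ 2 • (1 : L) := fun i hi =>
    (Finset.single_le_sum (f := fun i => w i • (star (a i) * a i))
      (fun j _ => smul_nonneg (hw j) (star_mul_self_nonneg _)) hi).trans
      ((colNorm_le_iff hw (colNorm_nonneg s w a)).1 le_rfl)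
  have hab : ∑ i ∈ s, w i • (star (a i * b i) * (a i * b i)) ≤
      c ^ 2 • ∑ i ∈ s, (1 : ℝ) • (star (b i) * b i) := by
    rw [Finset.smul_sum]
    refine Finset.sum_le_sum fun i hi => ?_
    simpa only [star_mul, mul_assoc, mul_smul_comm, smul_mul_assoc, one_mul, one_smul] using
      star_left_conjugate_le_conjugate (ha i hi) (b i)
  calc colNorm s w (fun i => a i * b i)
      ≤ √‖c ^ 2 • ∑ i ∈ s, (1 : ℝ) • (star (b i) * b i)‖ :=
        Real.sqrt_le_sqrt (CStarAlgebra.norm_le_norm_of_nonneg_of_le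
          (sum_smul_star_mul_self_nonneg hw) hab)
    _ = c * colNorm s 1 b := by
        rw [norm_smul, Real.sqrt_mul (norm_nonneg _), Real.norm_of_nonneg (sq_nonneg c),
          Real.sqrt_sq (colNorm_nonneg s w a)]
        rfl

theorem star_sum_mul_self_le (hc : 0 ≤ c) (ha : ∑ i ∈ s, a i * star (a i) ≤ c • (1 : L)) :
    star (∑ i ∈ s, a i * b i) * ∑ i ∈ s, a i * b i ≤ c • ∑ i ∈ s, star (b i) * b i := by
  let x : WithCStarModule L (s → L) := (WithCStarModule.equiv L (s → L)).symm fun i => a i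
  let y : WithCStarModule L (s → L) := (WithCStarModule.equiv L (s → L)).symm fun i => star (b i)
  have hcs := CStarModule.inner_mul_inner_swap_le (A := L) (x := x) (y := y)
  have hx : ‖x‖ ^ 2 = ‖∑ i ∈ s, a i * star (a i)‖ := by
    rw [WithCStarModule.pi_norm_sq, ← Finset.sum_coe_sort s]
    rfl
  simp only [hx, WithCStarModule.pi_inner, WithCStarModule.inner_def, x, y,
    WithCStarModule.equiv_symm_pi_apply, star_star,
    Finset.sum_coe_sort s fun i => star (b i) * star (a i),
    Finset.sum_coe_sort s fun i => star (b i) * b i,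
    Finset.sum_coe_sort s fun i => a i * b i] at hcs
  simp only [star_sum, star_mul]
  refine hcs.trans (smul_le_smul_of_nonneg_right ?_
    (Finset.sum_nonneg fun i _ => star_mul_self_nonneg _))
  exact (norm_le_iff_le_smul_one (Finset.sum_nonneg fun i _ => mul_star_self_nonneg _) hc).2 ha

theorem star_sum_mul_sum_le_card_smul (s : Finset ι) (b : ι → L) :
    star (∑ i ∈ s, b i) * ∑ i ∈ s, b i ≤ (s.card : ℝ) • ∑ i ∈ s, star (b i) * b i := by
  simpa using star_sum_mul_self_le (s := s) (a := fun _ => (1 : L)) (b := b) (c := s.card)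
    (Nat.cast_nonneg _) (by simp [Nat.cast_smul_eq_nsmul])

theorem norm_sum_mul_le_colNorm_mul_colNorm (hw : ∀ i, 0 < w i) (a b : ι → L) :
    ‖∑ i ∈ s, a i * b i‖ ≤ colNorm s w (fun i => star (a i)) * colNorm s w⁻¹ b := by
  set c := colNorm s w fun i => star (a i)
  have hc : 0 ≤ c := colNorm_nonneg _ _ _
  have ha : ∑ i ∈ s, (√(w i) • a i) * star (√(w i) • a i) ≤ c ^ 2 • (1 : L) := by
    have := (colNorm_le_iff (s := s) (a := fun i => star (a i)) (fun i => (hw i).le) hc).1 le_rfl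
    simpa only [star_smul, star_trivial, star_star, smul_mul_assoc, mul_smul_comm, smul_smul,
      Real.mul_self_sqrt (hw _).le] using this
  have hcs := star_sum_mul_self_le (b := fun i => (√(w i))⁻¹ • b i) (sq_nonneg c) ha
  simp only [star_smul, star_trivial, smul_mul_assoc, mul_smul_comm, smul_smul, ← mul_inv,
    Real.mul_self_sqrt (hw _).le, inv_mul_cancel₀ (Real.sqrt_pos.2 (hw _)).ne', one_smul] at hcs
  have hnorm := CStarAlgebra.norm_le_norm_of_nonneg_of_le (star_mul_self_nonneg _) hcs
  rw [CStarRing.norm_star_mul_self, norm_smul, Real.norm_of_nonneg (sq_nonneg c)] at hnorm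
  rw [← Real.sqrt_mul_self (norm_nonneg (∑ i ∈ s, a i * b i)), ← Real.sqrt_sq hc, colNorm,
    ← Real.sqrt_mul (sq_nonneg c)]
  exact Real.sqrt_le_sqrt hnorm

end CStar

section RowContraction

variable {L : Type*} [CStarAlgebra L] [PartialOrder L] [StarOrderedRing L] {n : ℕ} {T : Fin n → L}
  {c : ℝ}

theorem sum_words_star_mul_self_le (hc : 0 ≤ c) (hT : ∑ i, star (T i) * T i ≤ c • (1 : L))
    (k : ℕ) : ∑ α ∈ words n k, star (wordProd T α) * wordProd T α ≤ c ^ k • (1 : L) := by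
  induction k with
  | zero => simp [words_zero, wordProd_one]
  | succ k ih =>
    rw [sum_words_succ, Finset.sum_comm]
    calc ∑ α ∈ words n k, ∑ i,
          star (wordProd T (FreeMonoid.of i * α)) * wordProd T (FreeMonoid.of i * α)
        = ∑ α ∈ words n k, star (wordProd T α) * (∑ i, star (T i) * T i) * wordProd T α := by
          simp only [wordProd_of_mul, star_mul, Finset.mul_sum, Finset.sum_mul, mul_assoc]
      _ ≤ ∑ α ∈ words n k, star (wordProd T α) * (c • (1 : L)) * wordProd T α :=
          Finset.sum_le_sum fun α _ => star_left_conjugate_le_conjugate hT _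
      _ = c • ∑ α ∈ words n k, star (wordProd T α) * wordProd T α := by
          simp only [Finset.smul_sum, mul_smul_comm, smul_mul_assoc, mul_one]
      _ ≤ c • c ^ k • (1 : L) := smul_le_smul_of_nonneg_left ih hc
      _ = c ^ (k + 1) • (1 : L) := by rw [smul_smul, pow_succ']

theorem colNorm_wordMean_le (hc : 0 ≤ c) (hT : colNorm Finset.univ 1 T ≤ c) (k : ℕ) :
    colNorm (multiIdx n k) multiCoef (wordMean T) ≤ c ^ k := by
  have hT' := (colNorm_le_iff (w := 1) (fun _ => zero_le_one) hc).1 hT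
  rw [colNorm_le_iff (fun p => (multiCoef_pos p).le) (pow_nonneg hc k), ← pow_mul, mul_comm k 2,
    pow_mul]
  refine le_trans ?_ (sum_words_star_mul_self_le (sq_nonneg c) (by simpa using hT') k)
  rw [← sum_multiIdx_sum_wordFin]
  refine Finset.sum_le_sum fun p _ => ?_
  have hm := multiCoef_pos p
  have hmean := smul_le_smul_of_nonneg_left
    (star_sum_mul_sum_le_card_smul (wordFin p) (wordProd T)) (inv_nonneg.2 hm.le)
  rw [card_wordFin, inv_smul_smul₀ hm.ne'] at hmean
  simpa only [wordMean, star_smul, star_trivial, smul_mul_assoc, mul_smul_comm,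
    smul_inv_smul₀ hm.ne'] using hmean

theorem colNorm_star_wordMean_le (hc : 0 ≤ c)
    (hT : colNorm Finset.univ 1 (fun i => star (T i)) ≤ c) (k : ℕ) :
    colNorm (multiIdx n k) multiCoef (fun p => star (wordMean T p)) ≤ c ^ k := by
  simpa only [star_wordMean] using colNorm_wordMean_le hc hT k

theorem colNorm_tuplePow_le (hcomm : ∀ i j, Commute (T i) (T j)) (hc : 0 ≤ c)
    (hT : colNorm Finset.univ 1 T ≤ c) (k : ℕ) :
    colNorm (multiIdx n k) multiCoef (tuplePow T) ≤ c ^ k := by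
  simpa only [funext (wordMean_eq_tuplePow hcomm)] using colNorm_wordMean_le hc hT k

theorem colNorm_star_tuplePow_le (hcomm : ∀ i j, Commute (T i) (T j)) (hc : 0 ≤ c)
    (hT : colNorm Finset.univ 1 (fun i => star (T i)) ≤ c) (k : ℕ) :
    colNorm (multiIdx n k) multiCoef (fun p => star (tuplePow T p)) ≤ c ^ k := by
  simpa only [wordMean_eq_tuplePow hcomm] using colNorm_star_wordMean_le hc hT k

variable {M N : Type*} [CStarAlgebra M] [CStarAlgebra N]

theorem norm_sum_tuplePow_mul_map_mul_map_le (π : M →⋆ₐ[ℂ] L) (ψ : N →⋆ₐ[ℂ] L)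
    (hT : ∀ i j, Commute (T i) (T j)) (hT1 : colNorm Finset.univ 1 (fun i => star (T i)) ≤ 1)
    (C : (Fin n → ℕ) → M) (Y : (Fin n → ℕ) → N) (k : ℕ) :
    ‖∑ p ∈ multiIdx n k, tuplePow T p * π (C p) * ψ (Y p)‖ ≤
      colNorm (multiIdx n k) multiCoef⁻¹ C * colNorm (multiIdx n k) multiCoef Y := by
  have hrow : colNorm (multiIdx n k) multiCoef (fun p => star (tuplePow T p)) ≤ 1 := by
    simpa using colNorm_star_tuplePow_le hT zero_le_one hT1 k
  have hY : colNorm (multiIdx n k) 1 (fun p => ψ (Y p)) ≤ colNorm (multiIdx n k) multiCoef Y :=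
    (colNorm_mono (fun _ => zero_le_one) one_le_multiCoef).trans (colNorm_map_le ψ _ _ Y)
  calc ‖∑ p ∈ multiIdx n k, tuplePow T p * π (C p) * ψ (Y p)‖
      = ‖∑ p ∈ multiIdx n k, tuplePow T p * (π (C p) * ψ (Y p))‖ := by simp only [mul_assoc]
    _ ≤ 1 * colNorm (multiIdx n k) multiCoef⁻¹ (fun p => π (C p) * ψ (Y p)) :=
        (norm_sum_mul_le_colNorm_mul_colNorm multiCoef_pos _ _).trans
          (mul_le_mul_of_nonneg_right hrow (colNorm_nonneg _ _ _))
    _ ≤ colNorm (multiIdx n k) multiCoef⁻¹ (fun p => π (C p)) *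
          colNorm (multiIdx n k) 1 (fun p => ψ (Y p)) := by
        rw [one_mul]
        exact colNorm_mul_le inv_multiCoef_nonneg
    _ ≤ _ := mul_le_mul (colNorm_map_le π _ _ C) hY (colNorm_nonneg _ _ _) (colNorm_nonneg _ _ _)

end RowContraction

section Bohr

variable {L M N : Type*} [CStarAlgebra L] [PartialOrder L] [StarOrderedRing L]
  [CStarAlgebra M] [PartialOrder M] [StarOrderedRing M] [CStarAlgebra N] {n : ℕ}

/-- The Carathéodory-type coefficient inequalities satisfied by the power series with
`Re f_sym ≤ 1` and `f(0) ≥ 0`. For a number `A 0 < 1` the last one is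
`(∑_{|p| = k} (p! / |p|!) |A p|²)^{1/2} ≤ 2 (1 - A 0)`; in a noncommutative algebra the factor
`1 - A 0` has to be distributed over both sides of `A p`. -/
structure IsCaratheodory (A : (Fin n → ℕ) → M) : Prop where
  zero_le : 0 ≤ A 0
  le_one : A 0 ≤ 1
  colNorm_conj_le (r : M) (hr : IsSelfAdjoint r) (hrA : r * (1 - A 0) * r ≤ 1) (k : ℕ)
    (hk : 1 ≤ k) : colNorm (multiIdx n k) multiCoef⁻¹ (fun p => r * A p * r) ≤ 2

theorem IsCaratheodory.colNorm_le {A : (Fin n → ℕ) → M} (hA : IsCaratheodory A) {k : ℕ}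
    (hk : 1 ≤ k) : colNorm (multiIdx n k) multiCoef⁻¹ A ≤ 2 * ‖1 - A 0‖ := by
  refine le_of_forall_pos_le_add fun ε hε => ?_
  set d : ℝ := ‖1 - A 0‖ + ε / 2
  have hd : 0 < d := by positivity
  set t : ℝ := √d⁻¹
  have ht : t * t = d⁻¹ := Real.mul_self_sqrt (inv_nonneg.2 hd.le)
  have hAd : 1 - A 0 ≤ d • (1 : M) :=
    (norm_le_iff_le_smul_one (sub_nonneg.2 hA.le_one) hd.le).1
      (le_add_of_nonneg_right (by positivity))
  have hconj := hA.colNorm_conj_le (t • 1) ((IsSelfAdjoint.all t).smul (.one M)) (by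
    simpa only [smul_mul_assoc, mul_smul_comm, one_mul, mul_one, smul_smul, ht,
      inv_mul_cancel₀ hd.ne', one_smul] using
      smul_le_smul_of_nonneg_left hAd (inv_nonneg.2 hd.le)) k hk
  simp only [smul_mul_assoc, mul_smul_comm, one_mul, mul_one, smul_smul, ht, colNorm_smul,
    abs_of_pos (inv_pos.2 hd)] at hconj
  calc colNorm (multiIdx n k) multiCoef⁻¹ A ≤ d * 2 := (inv_mul_le_iff₀ hd).1 hconj
    _ = 2 * ‖1 - A 0‖ + ε := by ring

theorem exists_isSelfAdjoint_inv_sqrt {d : M} (hd : 0 ≤ d) {ε : ℝ} (hε : 0 < ε) :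
    ∃ s r : M, IsSelfAdjoint s ∧ IsSelfAdjoint r ∧ s * s = d + ε • (1 : M) ∧ s * r = 1 ∧
      r * s = 1 := by
  have hpos : IsStrictlyPositive (d + ε • (1 : M)) :=
    ((isUnit_one.smul (Units.mk0 ε hε.ne')).isStrictlyPositive
      (smul_nonneg hε.le zero_le_one)).nonneg_add hd
  obtain ⟨u, hu⟩ := CFC.isUnit_sqrt_iff_isStrictlyPositive.2 hpos
  have hsa : IsSelfAdjoint (u : M) := hu ▸ (CFC.sqrt_nonneg _).isSelfAdjoint
  have hustar : star u = u := Units.ext hsa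
  refine ⟨u, (u⁻¹ : Mˣ), hsa, ?_, ?_, u.mul_inv, u.inv_mul⟩
  · rw [IsSelfAdjoint, ← Units.coe_star, star_inv, hustar]
  · rw [hu, CFC.sqrt_mul_sqrt_self _ hpos.nonneg]

theorem IsCaratheodory.exists_factorization {A : (Fin n → ℕ) → M} (hA : IsCaratheodory A) {ε : ℝ}
    (hε : 0 < ε) : ∃ (s : M) (C : (Fin n → ℕ) → M), IsSelfAdjoint s ∧
      s * s = 1 - A 0 + ε • (1 : M) ∧ (∀ p, A p = s * C p * s) ∧
      ∀ k, colNorm (multiIdx n (k + 1)) multiCoef⁻¹ C ≤ 2 := by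
  obtain ⟨s, r, hs, hr, hss, hsr, hrs⟩ :=
    exists_isSelfAdjoint_inv_sqrt (sub_nonneg.2 hA.le_one) hε
  refine ⟨s, fun p => r * A p * r, hs, hss, fun p => ?_, fun k =>
    hA.colNorm_conj_le r hr ?_ (k + 1) (Nat.le_add_left 1 k)⟩
  · rw [← mul_assoc, ← mul_assoc, hsr, one_mul, mul_assoc, hrs, mul_one]
  · have hle : 1 - A 0 ≤ s * s := hss ▸ le_add_of_nonneg_right (smul_nonneg hε.le zero_le_one)
    calc r * (1 - A 0) * r ≤ r * (s * s) * r := hr.conjugate_le_conjugate hle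
      _ = 1 := by rw [← mul_assoc, hrs, one_mul, hsr]

theorem star_mul_self_le_one {g : L} (hg : ‖g‖ ≤ 1) : star g * g ≤ 1 := by
  have hnorm : ‖star g * g‖ ≤ 1 := by
    rw [CStarRing.norm_star_mul_self]
    exact mul_le_one₀ hg (norm_nonneg _) hg
  simpa using (norm_le_iff_le_smul_one (star_mul_self_nonneg g) zero_le_one).1 hnorm

theorem norm_conj_add_conj_le {q s y g : L} {c : ℝ} (hc : 0 ≤ c) (hq : IsSelfAdjoint q)
    (hs : IsSelfAdjoint s) (hqs : q * q + s * s ≤ c • (1 : L)) (hy : ‖y‖ ≤ 1) (hg : ‖g‖ ≤ 1) :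
    ‖q * (y * q) + s * (g * s)‖ ≤ c := by
  have hcs := norm_sum_mul_le_colNorm_mul_colNorm (s := Finset.univ) (w := 1)
    (fun _ => one_pos) ![q, s] ![y * q, g * s]
  have hconj : ∀ {t u : L}, IsSelfAdjoint t → ‖u‖ ≤ 1 → star (u * t) * (u * t) ≤ t * t :=
    fun {t u} ht hu => by
      simpa [mul_assoc, ht.star_eq] using ht.conjugate_le_conjugate (star_mul_self_le_one hu)
  have hrow : colNorm Finset.univ 1 (fun i => star (![q, s] i)) ≤ √c :=
    (colNorm_le_iff (fun _ => zero_le_one) (Real.sqrt_nonneg c)).2 (by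
      simpa [Fin.sum_univ_two, hq.star_eq, hs.star_eq, Real.sq_sqrt hc] using hqs)
  have hcol : colNorm Finset.univ 1⁻¹ ![y * q, g * s] ≤ √c :=
    (colNorm_le_iff (by simp) (Real.sqrt_nonneg c)).2 (by
      simpa [Fin.sum_univ_two, Real.sq_sqrt hc] using
        (add_le_add (hconj hq hy) (hconj hs hg)).trans hqs)
  calc ‖q * (y * q) + s * (g * s)‖ = ‖∑ i, ![q, s] i * ![y * q, g * s] i‖ := by
        simp [Fin.sum_univ_two]
    _ ≤ √c * √c := hcs.trans (mul_le_mul hrow hcol (colNorm_nonneg _ _ _) (Real.sqrt_nonneg c))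
    _ = c := Real.mul_self_sqrt hc

variable {π : M →⋆ₐ[ℂ] L} {ψ : N →⋆ₐ[ℂ] L} {Z : Fin n → L}

theorem summable_sum_tuplePow_mul_map_mul_map {A : (Fin n → ℕ) → M} (hA : IsCaratheodory A)
    (hZ : ∀ i j, Commute (Z i) (Z j)) (hZ1 : colNorm Finset.univ 1 (fun i => star (Z i)) ≤ 1)
    {Y : (Fin n → ℕ) → N} (hY : Summable fun k => colNorm (multiIdx n (k + 1)) multiCoef Y) :
    Summable fun k => ∑ p ∈ multiIdx n k, tuplePow Z p * π (A p) * ψ (Y p) := by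
  refine (summable_nat_add_iff 1).1 (.of_norm_bounded (hY.mul_left (2 * ‖1 - A 0‖)) fun k => ?_)
  exact (norm_sum_tuplePow_mul_map_mul_map_le π ψ hZ hZ1 A Y (k + 1)).trans
    (mul_le_mul_of_nonneg_right (hA.colNorm_le (Nat.le_add_left 1 k)) (colNorm_nonneg _ _ _))

theorem norm_tsum_tuplePow_mul_map_mul_map_le_one {A : (Fin n → ℕ) → M} (hA : IsCaratheodory A)
    (hZ : ∀ i j, Commute (Z i) (Z j)) (hZ1 : colNorm Finset.univ 1 (fun i => star (Z i)) ≤ 1)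
    (hZπ : ∀ i a, Commute (Z i) (π a)) (hψπ : ∀ b a, Commute (ψ b) (π a))
    {Y : (Fin n → ℕ) → N} (hY0 : ‖Y 0‖ ≤ 1)
    (hYs : Summable fun k => colNorm (multiIdx n (k + 1)) multiCoef Y)
    (hY : ∑' k, colNorm (multiIdx n (k + 1)) multiCoef Y ≤ 1 / 2) :
    ‖∑' k, ∑ p ∈ multiIdx n k, tuplePow Z p * π (A p) * ψ (Y p)‖ ≤ 1 := by
  refine le_of_forall_pos_le_add fun ε hε => ?_
  obtain ⟨s, C, hs, hss, hAC, hC⟩ := hA.exists_factorization hε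
  set g : ℕ → L := fun k => ∑ p ∈ multiIdx n (k + 1), tuplePow Z p * π (C p) * ψ (Y p)
  have hgle : ∀ k, ‖g k‖ ≤ 2 * colNorm (multiIdx n (k + 1)) multiCoef Y := fun k =>
    (norm_sum_tuplePow_mul_map_mul_map_le π ψ hZ hZ1 C Y (k + 1)).trans
      (mul_le_mul_of_nonneg_right (hC k) (colNorm_nonneg _ _ _))
  have hg : Summable g := .of_norm_bounded (hYs.mul_left 2) hgle
  have hg1 : ‖∑' k, g k‖ ≤ 1 := by
    refine (tsum_of_norm_bounded (hYs.mul_left 2).hasSum hgle).trans ?_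
    rw [tsum_mul_left]
    linarith
  have hpos : ∀ k, ∑ p ∈ multiIdx n (k + 1), tuplePow Z p * π (A p) * ψ (Y p) =
      π s * (g k * π s) := fun k => by
    rw [Finset.sum_mul, Finset.mul_sum]
    refine Finset.sum_congr rfl fun p _ => ?_
    rw [hAC p, map_mul, map_mul, mul_assoc _ (ψ (Y p)), (hψπ (Y p) s).eq]
    simp only [← mul_assoc, (commute_tuplePow (fun i => (hZπ i s).symm) p).eq]
  -- Split the constant term as `√A₀ Y₀ √A₀`: `√A₀` and `s` form a row of norm `√(1 + ε)`.
  set q : M := CFC.sqrt (A 0)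
  have hqq : q * q = A 0 := CFC.sqrt_mul_sqrt_self _ hA.zero_le
  have hsum : ∑' k, ∑ p ∈ multiIdx n k, tuplePow Z p * π (A p) * ψ (Y p) =
      π q * (ψ (Y 0) * π q) + π s * ((∑' k, g k) * π s) := by
    rw [(summable_sum_tuplePow_mul_map_mul_map hA hZ hZ1 hYs).tsum_eq_zero_add, multiIdx_zero,
      Finset.sum_singleton, tuplePow_zero, one_mul, (hψπ (Y 0) q).eq, ← mul_assoc, ← map_mul, hqq]
    simp only [hpos]
    rw [(hg.mul_right _).tsum_mul_left, hg.tsum_mul_right]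
  rw [hsum]
  refine norm_conj_add_conj_le (by positivity) ((CFC.sqrt_nonneg _).isSelfAdjoint.map π) (hs.map π)
    ?_ ((NonUnitalStarAlgHom.norm_apply_le ψ _).trans hY0) hg1
  rw [← map_mul, ← map_mul, ← map_add, hqq, hss, ← add_assoc, add_sub_cancel, map_add, map_one,
    starAlgHom_map_real_smul, map_one, add_smul, one_smul]

theorem bohr_sum_le {a : ℕ → ℝ} {d r : ℝ} (ha0 : ∀ k, 0 ≤ a k) (had : ∀ k, 1 ≤ k → a k ≤ 2 * d)
    (hr0 : 0 ≤ r) (hr : r ≤ 1 / 3) :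
    Summable (fun k => r ^ k * a k) ∧ ∑' k, r ^ k * a k ≤ a 0 + d := by
  have hle : ∀ k, r ^ (k + 1) * a (k + 1) ≤ 2 * d / 3 * (1 / 3) ^ k := fun k =>
    calc r ^ (k + 1) * a (k + 1) ≤ (1 / 3) ^ (k + 1) * (2 * d) := by
          gcongr
          · exact ha0 _
          · exact had _ (Nat.le_add_left 1 k)
      _ = _ := by ring
  have hgeom : HasSum (fun k : ℕ => 2 * d / 3 * (1 / 3 : ℝ) ^ k) d := by
    have h := (hasSum_geometric_of_lt_one (r := (1 / 3 : ℝ)) (by norm_num)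
      (by norm_num)).mul_left (2 * d / 3)
    rwa [show 2 * d / 3 * (1 - 1 / 3 : ℝ)⁻¹ = d by ring] at h
  have htail : Summable fun k => r ^ (k + 1) * a (k + 1) :=
    .of_nonneg_of_le (fun k => mul_nonneg (pow_nonneg hr0 _) (ha0 _)) hle hgeom.summable
  have hsum : Summable fun k => r ^ k * a k := (summable_nat_add_iff 1).1 htail
  refine ⟨hsum, ?_⟩
  rw [hsum.tsum_eq_zero_add, pow_zero, one_mul]
  gcongr
  exact hasSum_le hle htail.hasSum hgeom

end Bohr

section TensorOperators

variable {E F : Type*} [NormedAddCommGroup E] [InnerProductSpace ℂ E]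
  [NormedAddCommGroup F] [InnerProductSpace ℂ F]

/-- The elementary tensor `x ⊗ y`, bilinear in `x` and `y`. -/
def pureTensor : E →ₗ[ℂ] F →ₗ[ℂ] HTensor E F :=
  (TensorProduct.mk ℂ E F).compr₂ (UniformSpace.Completion.toComplₗᵢ (𝕜 := ℂ)).toLinearMap

theorem inner_pureTensor (x x' : E) (y y' : F) :
    inner ℂ (pureTensor x y) (pureTensor x' y') = inner ℂ x x' * inner ℂ y y' :=
  (UniformSpace.Completion.inner_coe _ _).trans (TensorProduct.inner_tmul ℂ x x' y y')

theorem opTensor_pureTensor (T : E →L[ℂ] E) (A : F →L[ℂ] F) (x : E) (y : F) :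
    opTensor T A (pureTensor x y) = pureTensor (T x) (A y) :=
  (TensorProduct.mapL T A).completion_apply_coe _

theorem dense_span_pureTensor :
    Dense (Submodule.span ℂ (Set.range fun z : E × F => pureTensor z.1 z.2) :
      Set (HTensor E F)) := by
  refine Dense.mono ?_ (UniformSpace.Completion.denseRange_coe (α := E ⊗[ℂ] F))
  rintro _ ⟨t, rfl⟩
  induction t using TensorProduct.induction_on with
  | zero => exact Submodule.zero_mem _
  | tmul x y => exact Submodule.subset_span ⟨(x, y), rfl⟩
  | add s t hs ht =>
    rw [UniformSpace.Completion.coe_add]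
    exact Submodule.add_mem _ hs ht

theorem ext_pureTensor {G : Type*} [NormedAddCommGroup G] [NormedSpace ℂ G]
    {f g : HTensor E F →L[ℂ] G} (h : ∀ x y, f (pureTensor x y) = g (pureTensor x y)) : f = g := by
  refine ContinuousLinearMap.ext_on dense_span_pureTensor ?_
  rintro _ ⟨z, rfl⟩
  exact h _ _

theorem opTensor_mul (T T' : E →L[ℂ] E) (A A' : F →L[ℂ] F) :
    opTensor (T * T') (A * A') = opTensor T A * opTensor T' A' :=
  ext_pureTensor fun x y => by simp [opTensor_pureTensor]

theorem opTensor_one : opTensor (1 : E →L[ℂ] E) (1 : F →L[ℂ] F) = 1 :=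
  ext_pureTensor fun x y => by simp [opTensor_pureTensor]

theorem opTensor_add_left (T T' : E →L[ℂ] E) (A : F →L[ℂ] F) :
    opTensor (T + T') A = opTensor T A + opTensor T' A :=
  ext_pureTensor fun x y => by simp [opTensor_pureTensor]

theorem opTensor_add_right (T : E →L[ℂ] E) (A A' : F →L[ℂ] F) :
    opTensor T (A + A') = opTensor T A + opTensor T A' :=
  ext_pureTensor fun x y => by simp [opTensor_pureTensor]

theorem opTensor_smul_left (c : ℂ) (T : E →L[ℂ] E) (A : F →L[ℂ] F) :
    opTensor (c • T) A = c • opTensor T A :=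
  ext_pureTensor fun x y => by simp [opTensor_pureTensor]

theorem opTensor_smul_right (c : ℂ) (T : E →L[ℂ] E) (A : F →L[ℂ] F) :
    opTensor T (c • A) = c • opTensor T A :=
  ext_pureTensor fun x y => by simp [opTensor_pureTensor]

variable [CompleteSpace E] [CompleteSpace F]

theorem star_opTensor (T : E →L[ℂ] E) (A : F →L[ℂ] F) :
    star (opTensor T A) = opTensor (star T) (star A) := by
  refine ext_pureTensor fun x y => ext_inner_right ℂ fun v => ?_
  have h : innerSL ℂ (pureTensor x y) ∘L opTensor T A =
      innerSL ℂ (opTensor (star T) (star A) (pureTensor x y)) :=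
    ext_pureTensor fun x' y' => by
      simp only [ContinuousLinearMap.comp_apply, innerSL_apply_apply, opTensor_pureTensor,
        inner_pureTensor, ContinuousLinearMap.star_eq_adjoint,
        ContinuousLinearMap.adjoint_inner_left]
  rw [ContinuousLinearMap.star_eq_adjoint, ContinuousLinearMap.adjoint_inner_left]
  exact DFunLike.congr_fun h v

variable (E F) in
/-- The representation `T ↦ T ⊗ I` of the operators on `E`. -/
def leftTensor : (E →L[ℂ] E) →⋆ₐ[ℂ] (HTensor E F →L[ℂ] HTensor E F) where
  toFun T := opTensor T 1
  map_one' := opTensor_one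
  map_mul' T T' := by rw [← opTensor_mul, mul_one]
  map_zero' := by simpa using opTensor_smul_left (0 : ℂ) (0 : E →L[ℂ] E) (1 : F →L[ℂ] F)
  map_add' T T' := opTensor_add_left T T' 1
  commutes' c := by
    rw [Algebra.algebraMap_eq_smul_one, Algebra.algebraMap_eq_smul_one, opTensor_smul_left,
      opTensor_one]
  map_star' T := by rw [star_opTensor, star_one]

variable (E F) in
/-- The representation `A ↦ I ⊗ A` of the operators on `F`. -/
def rightTensor : (F →L[ℂ] F) →⋆ₐ[ℂ] (HTensor E F →L[ℂ] HTensor E F) where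
  toFun A := opTensor 1 A
  map_one' := opTensor_one
  map_mul' A A' := by rw [← opTensor_mul, mul_one]
  map_zero' := by simpa using opTensor_smul_right (0 : ℂ) (1 : E →L[ℂ] E) (0 : F →L[ℂ] F)
  map_add' A A' := opTensor_add_right 1 A A'
  commutes' c := by
    rw [Algebra.algebraMap_eq_smul_one, Algebra.algebraMap_eq_smul_one, opTensor_smul_right,
      opTensor_one]
  map_star' A := by rw [star_opTensor, star_one]

theorem opTensor_eq_mul (T : E →L[ℂ] E) (A : F →L[ℂ] F) :
    opTensor T A = leftTensor E F T * rightTensor E F A := by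
  change _ = opTensor T 1 * opTensor 1 A
  rw [← opTensor_mul, mul_one, one_mul]

theorem commute_leftTensor_rightTensor (T : E →L[ℂ] E) (A : F →L[ℂ] F) :
    Commute (leftTensor E F T) (rightTensor E F A) := by
  change opTensor T 1 * opTensor 1 A = opTensor 1 A * opTensor T 1
  simp only [← opTensor_mul, mul_one, one_mul]

theorem norm_sum_opTensor_le {ι : Type*} {s : Finset ι} {w : ι → ℝ} (hw : ∀ i, 0 < w i)
    (X : ι → E →L[ℂ] E) (A : ι → F →L[ℂ] F) :
    ‖∑ i ∈ s, opTensor (X i) (A i)‖ ≤ colNorm s w (fun i => star (X i)) * colNorm s w⁻¹ A := by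
  simp only [opTensor_eq_mul]
  refine (norm_sum_mul_le_colNorm_mul_colNorm hw _ _).trans ?_
  simp only [← map_star]
  exact mul_le_mul (colNorm_map_le _ _ _ _) (colNorm_map_le _ _ _ _) (colNorm_nonneg _ _ _)
    (colNorm_nonneg _ _ _)

end TensorOperators

section Vectors

variable {H : Type*} [NormedAddCommGroup H] [InnerProductSpace ℂ H]

theorem re_inner_real_smul (c : ℝ) (T : H →L[ℂ] H) (x : H) :
    (inner ℂ x ((c • T) x)).re = c * (inner ℂ x (T x)).re := by
  change (inner ℂ x ((c : ℂ) • T x)).re = _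
  rw [inner_smul_right, Complex.re_ofReal_mul]

variable [CompleteSpace H]

theorem le_iff_forall_re_inner_le {S T : H →L[ℂ] H} (hS : IsSelfAdjoint S)
    (hT : IsSelfAdjoint T) : S ≤ T ↔ ∀ x, (inner ℂ x (S x)).re ≤ (inner ℂ x (T x)).re := by
  rw [ContinuousLinearMap.le_def, ContinuousLinearMap.isPositive_def']
  simp only [hT.sub hS, true_and, ContinuousLinearMap.reApplyInnerSelf_apply]
  refine forall_congr' fun x => ?_
  simp only [sub_apply, inner_sub_left, map_sub, sub_nonneg]
  rw [inner_re_symm, inner_re_symm (𝕜 := ℂ) (T x)]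
  rfl

theorem re_inner_star_mul_self (T : H →L[ℂ] H) (x : H) :
    (inner ℂ x ((star T * T) x)).re = ‖T x‖ ^ 2 := by
  rw [mul_apply_eq_comp, ContinuousLinearMap.star_eq_adjoint,
    ContinuousLinearMap.adjoint_inner_right]
  exact_mod_cast congrArg Complex.re (inner_self_eq_norm_sq_to_K (𝕜 := ℂ) (T x))

theorem colNorm_le_iff_forall {ι : Type*} {s : Finset ι} {w : ι → ℝ} {b : ι → H →L[ℂ] H} {c : ℝ}
    (hw : ∀ i, 0 ≤ w i) (hc : 0 ≤ c) :
    colNorm s w b ≤ c ↔ ∀ x, ∑ i ∈ s, w i * ‖b i x‖ ^ 2 ≤ c ^ 2 * ‖x‖ ^ 2 := by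
  have hsa : IsSelfAdjoint (∑ i ∈ s, w i • (star (b i) * b i)) :=
    isSelfAdjoint_sum _ fun i _ => (IsSelfAdjoint.all (w i)).smul (.star_mul_self (b i))
  rw [colNorm_le_iff hw hc,
    le_iff_forall_re_inner_le hsa ((IsSelfAdjoint.all (c ^ 2)).smul (.one _))]
  refine forall_congr' fun x => ?_
  have hone : (inner ℂ x ((1 : H →L[ℂ] H) x)).re = ‖x‖ ^ 2 := by
    simpa using re_inner_star_mul_self (1 : H →L[ℂ] H) x
  simp only [sum_apply, inner_sum, Complex.re_sum, re_inner_real_smul, re_inner_star_mul_self, hone]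

theorem colNorm_le_norm_rowOp_star {n : ℕ} (Y : Fin n → H →L[ℂ] H) :
    colNorm Finset.univ 1 Y ≤ ‖rowOp fun i => star (Y i)‖ := by
  refine (colNorm_le_iff_forall (fun _ => zero_le_one)
    (norm_nonneg (rowOp fun i => star (Y i)))).2 fun x => ?_
  set v : PiLp 2 (fun _ : Fin n => H) := WithLp.toLp 2 fun i => Y i x
  have hv : ‖v‖ ^ 2 = ∑ i, ‖Y i x‖ ^ 2 := PiLp.norm_sq_eq_of_L2 _ v
  have hinner : (inner ℂ x (rowOp (fun i => star (Y i)) v)).re = ‖v‖ ^ 2 := by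
    rw [hv, rowOp, sum_apply, inner_sum, Complex.re_sum]
    exact Finset.sum_congr rfl fun i _ => re_inner_star_mul_self (Y i) x
  have hle : ‖v‖ * ‖v‖ ≤ ‖rowOp fun i => star (Y i)‖ * ‖x‖ * ‖v‖ := by
    calc ‖v‖ * ‖v‖ = (inner ℂ x (rowOp (fun i => star (Y i)) v)).re := by rw [hinner, sq]
      _ ≤ ‖x‖ * ‖rowOp (fun i => star (Y i)) v‖ :=
          (Complex.re_le_norm _).trans (norm_inner_le_norm _ _)
      _ ≤ ‖x‖ * (‖rowOp fun i => star (Y i)‖ * ‖v‖) :=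
          mul_le_mul_of_nonneg_left (ContinuousLinearMap.le_opNorm _ v) (norm_nonneg x)
      _ = _ := by ring
  have hvx : ‖v‖ ≤ ‖rowOp fun i => star (Y i)‖ * ‖x‖ := by
    rcases (norm_nonneg v).eq_or_lt with h0 | h0
    · rw [← h0]; positivity
    · exact le_of_mul_le_mul_right hle h0
  simp only [one_mul]
  rw [← hv, ← mul_pow]
  gcongr

end Vectors

section Creation

variable {n : ℕ}

instance instDecidableEqFreeMonoidFin : DecidableEq (FreeMonoid (Fin n)) :=
  inferInstanceAs (DecidableEq (List (Fin n)))

theorem leftCreation_apply_of_mul (i : Fin n) (u : Fock n) (β : FreeMonoid (Fin n)) :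
    leftCreation i u (FreeMonoid.of i * β) = u β :=
  shiftFun_of_mul i _ β

theorem leftCreation_apply_of_mul_ne {i j : Fin n} (h : i ≠ j) (u : Fock n)
    (β : FreeMonoid (Fin n)) : leftCreation i u (FreeMonoid.of j * β) = 0 :=
  shiftFun_of_not_exists fun ⟨_, hγ⟩ => h (List.cons.inj hγ).1

theorem leftCreation_apply_one (i : Fin n) (u : Fock n) : leftCreation i u 1 = 0 :=
  shiftFun_of_not_exists fun ⟨_, hγ⟩ => List.cons_ne_nil _ _ hγ

/-- The basis vector `e_α` of the full Fock space. -/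
def fockBasis (α : FreeMonoid (Fin n)) : Fock n := lp.single 2 α (1 : ℂ)

theorem inner_fockBasis_left (α : FreeMonoid (Fin n)) (u : Fock n) :
    inner ℂ (fockBasis α) u = u α := by
  rw [fockBasis, lp.inner_single_left, RCLike.inner_apply, map_one, mul_one]

theorem inner_fockBasis (α β : FreeMonoid (Fin n)) :
    inner ℂ (fockBasis α) (fockBasis β) = if α = β then (1 : ℂ) else 0 := by
  rw [inner_fockBasis_left, fockBasis, lp.coeFn_single, Pi.single_apply]

theorem leftCreation_fockBasis (i : Fin n) (β : FreeMonoid (Fin n)) :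
    leftCreation i (fockBasis β) = fockBasis (FreeMonoid.of i * β) := by
  ext α
  rw [← inner_fockBasis_left α (fockBasis _), inner_fockBasis]
  induction α using FreeMonoid.inductionOn' with
  | one => rw [leftCreation_apply_one, if_neg fun h => List.cons_ne_nil _ _ h.symm]
  | of_mul j γ _ =>
    rcases eq_or_ne i j with rfl | hij
    · rw [leftCreation_apply_of_mul, ← inner_fockBasis_left, inner_fockBasis]
      simp only [mul_right_inj]
    · rw [leftCreation_apply_of_mul_ne hij, if_neg]
      exact fun h => hij (List.cons.inj h).1.symm

theorem wordProd_leftCreation_fockBasis (α β : FreeMonoid (Fin n)) :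
    wordProd leftCreation α (fockBasis β) = fockBasis (α * β) := by
  induction α using FreeMonoid.inductionOn' with
  | one => rw [wordProd_one, one_mul, one_apply_eq_self]
  | of_mul i γ ih =>
    rw [wordProd_of_mul, mul_apply_eq_comp, ih, leftCreation_fockBasis, mul_assoc]

theorem star_leftCreation_apply (i : Fin n) (u : Fock n) (β : FreeMonoid (Fin n)) :
    star (leftCreation i) u β = u (FreeMonoid.of i * β) := by
  rw [← inner_fockBasis_left, ContinuousLinearMap.star_eq_adjoint,
    ContinuousLinearMap.adjoint_inner_right, leftCreation_fockBasis, inner_fockBasis_left]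

theorem star_leftCreation_mul_leftCreation (i j : Fin n) :
    star (leftCreation i) * leftCreation j = if i = j then (1 : Fock n →L[ℂ] Fock n) else 0 := by
  ext u β
  rw [mul_apply_eq_comp, star_leftCreation_apply]
  split_ifs with h
  · subst h; exact leftCreation_apply_of_mul _ _ _
  · exact leftCreation_apply_of_mul_ne (Ne.symm h) _ _

theorem isStarProjection_sum_leftCreation_mul_star :
    IsStarProjection (∑ i : Fin n, leftCreation i * star (leftCreation i)) where
  isIdempotentElem := by
    have h : ∀ i j : Fin n, leftCreation i * star (leftCreation i) *
        (leftCreation j * star (leftCreation j)) =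
          if i = j then leftCreation i * star (leftCreation i) else 0 := fun i j => by
      rw [mul_assoc, ← mul_assoc (star (leftCreation i)), star_leftCreation_mul_leftCreation]
      split_ifs with hij <;> simp [hij]
    simp [IsIdempotentElem, Finset.sum_mul, Finset.mul_sum, h]
  isSelfAdjoint := isSelfAdjoint_sum _ fun _ _ => .mul_star_self _

theorem colNorm_star_leftCreation_le_one :
    colNorm Finset.univ 1 (fun i : Fin n => star (leftCreation i)) ≤ 1 := by
  rw [colNorm_one_le_one_iff]
  simpa only [star_star] using isStarProjection_sum_leftCreation_mul_star.le_one

theorem star_leftCreation_mem_symFock (i : Fin n) {u : Fock n} (hu : u ∈ symFock n) :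
    star (leftCreation i) u ∈ symFock n := fun α β hαβ => by
  rw [star_leftCreation_apply, star_leftCreation_apply]
  exact hu _ _ (hαβ.cons i)

theorem coe_star_symCreation_apply (i : Fin n) (u : symFock n) :
    (star (symCreation i) u : Fock n) = star (leftCreation i) u := by
  suffices h : star (symCreation i) u =
      ⟨star (leftCreation i) u, star_leftCreation_mem_symFock i u.2⟩ by rw [h]
  refine ext_inner_right ℂ fun v => ?_
  calc inner ℂ (star (symCreation i) u) v = inner ℂ u (symCreation i v) :=
        ContinuousLinearMap.adjoint_inner_left _ _ _
    _ = inner ℂ (u : Fock n) (leftCreation i (v : Fock n)) :=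
        Submodule.inner_orthogonalProjectionOnto_eq_of_mem_left u _
    _ = inner ℂ (star (leftCreation i) (u : Fock n)) (v : Fock n) :=
        (ContinuousLinearMap.adjoint_inner_left _ _ _).symm

theorem commute_symCreation (i j : Fin n) :
    Commute (symCreation i : symFock n →L[ℂ] symFock n) (symCreation j) := by
  refine commute_star_star.1 ?_
  ext u β
  simp only [mul_apply_eq_comp, coe_star_symCreation_apply, star_leftCreation_apply]
  exact u.2 _ _ (List.Perm.swap _ _ _)

theorem colNorm_star_symCreation_le_one :
    colNorm Finset.univ 1 (fun i : Fin n => star (symCreation i)) ≤ 1 := by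
  refine (colNorm_le_iff_forall (fun _ => zero_le_one) zero_le_one).2 fun u => ?_
  simpa only [Submodule.coe_norm, coe_star_symCreation_apply] using
    (colNorm_le_iff_forall (fun _ => zero_le_one) zero_le_one).1
      (colNorm_star_leftCreation_le_one (n := n)) u

/-- The vector `∑_{α ∈ Λ_p} e_α`. -/
def classVec (p : Fin n → ℕ) : Fock n := ∑ α ∈ wordFin p, fockBasis α

theorem inner_classVec (p q : Fin n → ℕ) :
    inner ℂ (classVec p) (classVec q) = if p = q then (multiCoef p : ℂ) else 0 := by
  simp only [classVec, sum_inner, inner_sum, inner_fockBasis, Finset.sum_ite_eq']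
  split_ifs with h
  · subst h
    simp [← card_wordFin]
  · refine Finset.sum_eq_zero fun α hα => if_neg fun hα' => h ?_
    rw [← mem_wordFin.1 hα, mem_wordFin.1 hα']

theorem symMonomial_leftCreation_classVec_zero (q : Fin n → ℕ) :
    symMonomial leftCreation q (classVec 0) = ((multiCoef q)⁻¹ : ℂ) • classVec q := by
  rw [symMonomial_apply, classVec, wordFin_zero, Finset.sum_singleton, classVec]
  simp only [wordProd_leftCreation_fockBasis, mul_one]

theorem inner_classVec_symMonomial_leftCreation {p p' q : Fin n → ℕ}
    (h : ∑ i, p' i ≠ ∑ i, q i + ∑ i, p i) :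
    inner ℂ (classVec p') (symMonomial leftCreation q (classVec p)) = 0 := by
  rw [symMonomial_apply, inner_smul_right]
  simp only [classVec, map_sum, wordProd_leftCreation_fockBasis, sum_inner, inner_sum,
    inner_fockBasis]
  refine mul_eq_zero_of_right _ (Finset.sum_eq_zero fun α hα => Finset.sum_eq_zero fun β hβ =>
    Finset.sum_eq_zero fun γ hγ => if_neg fun e => h ?_)
  rw [← mem_wordFin.1 hα, ← mem_wordFin.1 hβ, ← mem_wordFin.1 hγ, sum_content, sum_content,
    sum_content, e, FreeMonoid.length_mul]

end Creation

section Coefficients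

variable {n k : ℕ} {H : Type*} [NormedAddCommGroup H] [InnerProductSpace ℂ H]

/-- The homogeneous component of degree `m` of the series `f_sym(S₁, …, Sₙ)`. -/
def homPart (A : (Fin n → ℕ) → H →L[ℂ] H) (m : ℕ) :
    HTensor (Fock n) H →L[ℂ] HTensor (Fock n) H :=
  ∑ p ∈ multiIdx n m, opTensor (symMonomial leftCreation p) (A p)

/-- The vector `∑_{|p| = k} ∑_{α ∈ Λ_p} e_α ⊗ w_p`, a general element of degree `k` of
`F_s² ⊗ H`. -/
def symVec (k : ℕ) (w : (Fin n → ℕ) → H) : HTensor (Fock n) H :=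
  ∑ p ∈ multiIdx n k, pureTensor (classVec p) (w p)

theorem inner_symVec_opTensor_symVec (j l : ℕ) (w v : (Fin n → ℕ) → H)
    (T : Fock n →L[ℂ] Fock n) (B : H →L[ℂ] H) :
    inner ℂ (symVec j w) (opTensor T B (symVec l v)) =
      ∑ p ∈ multiIdx n j, ∑ q ∈ multiIdx n l,
        inner ℂ (classVec p) (T (classVec q)) * inner ℂ (w p) (B (v q)) := by
  simp only [symVec, map_sum, opTensor_pureTensor, sum_inner, inner_sum, inner_pureTensor]
  exact Finset.sum_comm

theorem inner_symVec_homPart_symVec_eq_zero (A : (Fin n → ℕ) → H →L[ℂ] H) {j l m : ℕ}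
    (h : j ≠ m + l) (w v : (Fin n → ℕ) → H) :
    inner ℂ (symVec j w) (homPart A m (symVec l v)) = 0 := by
  rw [homPart, sum_apply, inner_sum]
  refine Finset.sum_eq_zero fun q hq => ?_
  rw [inner_symVec_opTensor_symVec]
  refine Finset.sum_eq_zero fun p' hp' => Finset.sum_eq_zero fun p hp => ?_
  rw [inner_classVec_symMonomial_leftCreation, zero_mul]
  rwa [mem_multiIdx.1 hp', mem_multiIdx.1 hq, mem_multiIdx.1 hp]

theorem inner_symVec_homPart_symVec_zero (A : (Fin n → ℕ) → H →L[ℂ] H) (k : ℕ)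
    (w v : (Fin n → ℕ) → H) :
    inner ℂ (symVec k w) (homPart A k (symVec 0 v)) =
      ∑ q ∈ multiIdx n k, inner ℂ (w q) (A q (v 0)) := by
  rw [homPart, sum_apply, inner_sum]
  refine Finset.sum_congr rfl fun q hq => ?_
  have hne : (multiCoef q : ℂ) ≠ 0 := Complex.ofReal_ne_zero.2 (multiCoef_pos q).ne'
  simp only [inner_symVec_opTensor_symVec, multiIdx_zero, Finset.sum_singleton,
    symMonomial_leftCreation_classVec_zero, inner_smul_right, inner_classVec]
  rw [Finset.sum_eq_single_of_mem q hq fun p _ hp => by rw [if_neg hp, mul_zero, zero_mul],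
    if_pos rfl, inv_mul_cancel₀ hne, one_mul]

theorem inner_symVec_opTensor_one_symVec (B : H →L[ℂ] H) (k : ℕ) (w v : (Fin n → ℕ) → H) :
    inner ℂ (symVec k w) (opTensor 1 B (symVec k v)) =
      ∑ p ∈ multiIdx n k, (multiCoef p : ℂ) * inner ℂ (w p) (B (v p)) := by
  rw [inner_symVec_opTensor_symVec]
  refine Finset.sum_congr rfl fun p hp => ?_
  simp only [one_apply_eq_self, inner_classVec]
  rw [Finset.sum_eq_single_of_mem p hp fun q _ hq => by rw [if_neg hq.symm, zero_mul], if_pos rfl]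

theorem homPart_zero (A : (Fin n → ℕ) → H →L[ℂ] H) : homPart A 0 = opTensor 1 (A 0) := by
  rw [homPart, multiIdx_zero, Finset.sum_singleton, symMonomial_eq_wordMean, wordMean_zero]

theorem inner_testVec_homPart_zero (A : (Fin n → ℕ) → H →L[ℂ] H) (hk : 1 ≤ k) (x : H)
    (w : (Fin n → ℕ) → H) :
    inner ℂ (symVec 0 (fun _ => x) + symVec k w)
        (homPart A 0 (symVec 0 (fun _ => x) + symVec k w)) =
      inner ℂ x (A 0 x) + ∑ p ∈ multiIdx n k, (multiCoef p : ℂ) * inner ℂ (w p) (A 0 (w p)) := by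
  rw [map_add, inner_add_left, inner_add_right, inner_add_right,
    inner_symVec_homPart_symVec_zero, inner_symVec_homPart_symVec_eq_zero A (by omega),
    inner_symVec_homPart_symVec_eq_zero A (by omega), homPart_zero,
    inner_symVec_opTensor_one_symVec, multiIdx_zero, Finset.sum_singleton, add_zero, zero_add]

theorem inner_testVec_homPart_self (A : (Fin n → ℕ) → H →L[ℂ] H) (hk : 1 ≤ k) (x : H)
    (w : (Fin n → ℕ) → H) :
    inner ℂ (symVec 0 (fun _ => x) + symVec k w)
        (homPart A k (symVec 0 (fun _ => x) + symVec k w)) =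
      ∑ q ∈ multiIdx n k, inner ℂ (w q) (A q x) := by
  rw [map_add, inner_add_left, inner_add_right, inner_add_right,
    inner_symVec_homPart_symVec_zero, inner_symVec_homPart_symVec_eq_zero A (by omega),
    inner_symVec_homPart_symVec_eq_zero A (by omega),
    inner_symVec_homPart_symVec_eq_zero A (by omega), zero_add, zero_add, add_zero]

theorem inner_testVec_homPart_eq_zero (A : (Fin n → ℕ) → H →L[ℂ] H) {m : ℕ} (hm : m ≠ 0)
    (hmk : m ≠ k) (x : H) (w : (Fin n → ℕ) → H) :
    inner ℂ (symVec 0 (fun _ => x) + symVec k w)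
      (homPart A m (symVec 0 (fun _ => x) + symVec k w)) = 0 := by
  rw [map_add, inner_add_left, inner_add_right, inner_add_right,
    inner_symVec_homPart_symVec_eq_zero A (by omega),
    inner_symVec_homPart_symVec_eq_zero A (by omega),
    inner_symVec_homPart_symVec_eq_zero A (by omega),
    inner_symVec_homPart_symVec_eq_zero A (by omega)]
  simp only [add_zero]

theorem inner_testVec_self (hk : 1 ≤ k) (x : H) (w : (Fin n → ℕ) → H) :
    inner ℂ (symVec 0 (fun _ => x) + symVec k w) (symVec 0 (fun _ => x) + symVec k w) =
      inner ℂ x x + ∑ p ∈ multiIdx n k, (multiCoef p : ℂ) * inner ℂ (w p) (w p) := by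
  simpa [homPart_zero, opTensor_one] using
    inner_testVec_homPart_zero (fun _ => (1 : H →L[ℂ] H)) hk x w

variable [CompleteSpace H] {A : (Fin n → ℕ) → H →L[ℂ] H}

theorem norm_homPart_le (A : (Fin n → ℕ) → H →L[ℂ] H) (m : ℕ) :
    ‖homPart A m‖ ≤ colNorm (multiIdx n m) multiCoef⁻¹ A := by
  have hrow : colNorm (multiIdx n m) multiCoef
      (fun p => star (symMonomial (leftCreation (n := n)) p)) ≤ 1 := by
    simpa only [symMonomial_eq_wordMean, one_pow] using
      colNorm_star_wordMean_le zero_le_one (colNorm_star_leftCreation_le_one (n := n)) m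
  calc ‖homPart A m‖ ≤ 1 * colNorm (multiIdx n m) multiCoef⁻¹ A :=
        (norm_sum_opTensor_le multiCoef_pos _ A).trans
          (mul_le_mul_of_nonneg_right hrow (colNorm_nonneg _ _ _))
    _ = _ := one_mul _

theorem hasSum_symCalculus {r : ℝ} (hr : 0 ≤ r)
    (hA : Summable fun k => r ^ k * colNorm (multiIdx n k) multiCoef⁻¹ A) :
    HasSum (fun k => (r : ℂ) ^ k • homPart A k)
      (symCalculus A fun i => (r : ℂ) • leftCreation (n := n) i) := by
  have hterm : ∀ k, ∑ p ∈ multiIdx n k,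
      opTensor (symMonomial (fun i => (r : ℂ) • leftCreation (n := n) i) p) (A p) =
      (r : ℂ) ^ k • homPart A k := fun k => by
    rw [homPart, Finset.smul_sum]
    refine Finset.sum_congr rfl fun p hp => ?_
    rw [symMonomial_smul, opTensor_smul_left, mem_multiIdx.1 hp]
  simp only [symCalculus, hterm]
  refine (Summable.of_norm_bounded hA fun k => ?_).hasSum
  rw [norm_smul, norm_pow, Complex.norm_real, Real.norm_of_nonneg hr]
  exact mul_le_mul_of_nonneg_left (norm_homPart_le A k) (pow_nonneg hr k)

theorem inner_testVec_symCalculus {r : ℝ} (hr : 0 ≤ r)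
    (hA : Summable fun k => r ^ k * colNorm (multiIdx n k) multiCoef⁻¹ A) (hk : 1 ≤ k) (x : H)
    (w : (Fin n → ℕ) → H) :
    inner ℂ (symVec 0 (fun _ => x) + symVec k w)
        (symCalculus A (fun i => (r : ℂ) • leftCreation (n := n) i)
          (symVec 0 (fun _ => x) + symVec k w)) =
      inner ℂ x (A 0 x) + ∑ p ∈ multiIdx n k, (multiCoef p : ℂ) * inner ℂ (w p) (A 0 (w p)) +
        (r : ℂ) ^ k * ∑ q ∈ multiIdx n k, inner ℂ (w q) (A q x) := by
  have hsum := (hasSum_symCalculus hr hA).mapL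
    (innerSL ℂ (symVec 0 (fun _ => x) + symVec k w) ∘L
      ContinuousLinearMap.apply ℂ _ (symVec 0 (fun _ => x) + symVec k w))
  simp only [map_smul, ContinuousLinearMap.comp_apply, ContinuousLinearMap.apply_apply,
    innerSL_apply_apply, smul_eq_mul] at hsum
  rw [hsum.unique (hasSum_sum_of_ne_finset_zero (s := {0, k}) fun m hm => ?_),
    Finset.sum_pair (by omega), inner_testVec_homPart_zero A hk,
    inner_testVec_homPart_self A hk, pow_zero, one_mul]
  rw [Finset.mem_insert, Finset.mem_singleton, not_or] at hm
  rw [inner_testVec_homPart_eq_zero A hm.1 hm.2, mul_zero]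

theorem re_inner_le_of_realPart_le_one {T : H →L[ℂ] H} (hT : (ℜ T : H →L[ℂ] H) ≤ 1) (x : H) :
    (inner ℂ x (T x)).re ≤ (inner ℂ x x).re := by
  have hre : (inner ℂ x ((ℜ T : H →L[ℂ] H) x)).re = (inner ℂ x (T x)).re := by
    have hstar : (inner ℂ x (star T x)).re = (inner ℂ x (T x)).re := by
      rw [ContinuousLinearMap.star_eq_adjoint, ContinuousLinearMap.adjoint_inner_right]
      exact inner_re_symm (𝕜 := ℂ) _ _
    rw [realPart_apply_coe, re_inner_real_smul, add_apply, inner_add_right, Complex.add_re, hstar]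
    ring
  have hsa : IsSelfAdjoint (ℜ T : H →L[ℂ] H) := (ℜ T).2
  simpa only [hre, one_apply_eq_self] using (le_iff_forall_re_inner_le hsa (.one _)).1 hT x

theorem sum_re_inner_le
    (hA : ∀ r : ℝ, 0 ≤ r → r < 1 →
      Summable fun k => r ^ k * colNorm (multiIdx n k) multiCoef⁻¹ A)
    (hre : ∀ r : ℝ, 0 ≤ r → r < 1 →
      (ℜ (symCalculus A fun i => (r : ℂ) • leftCreation (n := n) i) :
        HTensor (Fock n) H →L[ℂ] HTensor (Fock n) H) ≤ 1)
    (hk : 1 ≤ k) (x : H) (w : (Fin n → ℕ) → H) :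
    ∑ q ∈ multiIdx n k, (inner ℂ (w q) (A q x)).re ≤
      (inner ℂ x ((1 - A 0) x)).re +
        ∑ p ∈ multiIdx n k, multiCoef p * (inner ℂ (w p) ((1 - A 0) (w p))).re := by
  have hlt : ∀ r : ℝ, 0 ≤ r → r < 1 → r ^ k * ∑ q ∈ multiIdx n k, (inner ℂ (w q) (A q x)).re ≤
      (inner ℂ x ((1 - A 0) x)).re +
        ∑ p ∈ multiIdx n k, multiCoef p * (inner ℂ (w p) ((1 - A 0) (w p))).re :=
    fun r hr0 hr1 => by
    have h := re_inner_le_of_realPart_le_one (hre r hr0 hr1) (symVec 0 (fun _ => x) + symVec k w)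
    rw [inner_testVec_symCalculus hr0 (hA r hr0 hr1) hk, inner_testVec_self hk,
      ← Complex.ofReal_pow] at h
    simp only [Complex.add_re, Complex.re_sum, Complex.re_ofReal_mul] at h
    simp only [sub_apply, one_apply_eq_self, inner_sub_right, Complex.sub_re, mul_sub,
      Finset.sum_sub_distrib]
    linarith
  have hlim : Tendsto (fun r : ℝ => r ^ k * ∑ q ∈ multiIdx n k, (inner ℂ (w q) (A q x)).re)
      (nhdsWithin 1 (Set.Iio 1)) (nhds (∑ q ∈ multiIdx n k, (inner ℂ (w q) (A q x)).re)) :=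
    ((continuous_pow k).mul continuous_const).continuousWithinAt.tendsto.trans_eq (by simp)
  refine le_of_tendsto hlim ?_
  filter_upwards [Ioo_mem_nhdsLT (zero_lt_one' ℝ)] with r hr
  exact hlt r hr.1.le hr.2

theorem re_inner_le_of_conj_le_one {r d : H →L[ℂ] H} (hr : IsSelfAdjoint r)
    (hd : IsSelfAdjoint d) (hrd : r * d * r ≤ 1) (y : H) :
    (inner ℂ (r y) (d (r y))).re ≤ ‖y‖ ^ 2 := by
  have hsa : IsSelfAdjoint (r * d * r) := by simpa only [hr.star_eq] using hd.conjugate r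
  calc (inner ℂ (r y) (d (r y))).re = (inner ℂ y ((r * d * r) y)).re :=
        congrArg Complex.re (hr.isSymmetric y _)
    _ ≤ (inner ℂ y y).re := (le_iff_forall_re_inner_le hsa (.one _)).1 hrd y
    _ = ‖y‖ ^ 2 := inner_self_eq_norm_sq (𝕜 := ℂ) y

theorem colNorm_conj_le_two (hA0 : IsSelfAdjoint (A 0))
    (h : ∀ (x : H) (w : (Fin n → ℕ) → H),
      ∑ q ∈ multiIdx n k, (inner ℂ (w q) (A q x)).re ≤
        (inner ℂ x ((1 - A 0) x)).re +
          ∑ p ∈ multiIdx n k, multiCoef p * (inner ℂ (w p) ((1 - A 0) (w p))).re)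
    {r : H →L[ℂ] H} (hr : IsSelfAdjoint r) (hrA : r * (1 - A 0) * r ≤ 1) :
    colNorm (multiIdx n k) multiCoef⁻¹ (fun p => r * A p * r) ≤ 2 := by
  refine (colNorm_le_iff_forall inv_multiCoef_nonneg zero_le_two).2 fun ξ => ?_
  have hdef := re_inner_le_of_conj_le_one hr ((IsSelfAdjoint.one _).sub hA0) hrA
  -- Testing on `x = r ξ` and `w_q = r y_q`; the factor `1 / 2` in `y_q` is the optimal one.
  set η : (Fin n → ℕ) → H := fun q => (r * A q * r) ξ
  set s := ∑ q ∈ multiIdx n k, (multiCoef q)⁻¹ * ‖η q‖ ^ 2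
  set y : (Fin n → ℕ) → H := fun q => ((2⁻¹ * (multiCoef q)⁻¹ : ℝ) : ℂ) • η q
  have hleft : ∑ q ∈ multiIdx n k, (inner ℂ (r (y q)) (A q (r ξ))).re = 2⁻¹ * s := by
    rw [Finset.mul_sum]
    refine Finset.sum_congr rfl fun q _ => ?_
    rw [hr.isSymmetric.apply_clm, inner_smul_left, Complex.conj_ofReal, Complex.re_ofReal_mul,
      ← mul_assoc]
    exact congrArg _ (inner_self_eq_norm_sq (𝕜 := ℂ) (η q))
  have hright : ∑ q ∈ multiIdx n k,
      multiCoef q * (inner ℂ (r (y q)) ((1 - A 0) (r (y q)))).re ≤ 4⁻¹ * s := by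
    rw [Finset.mul_sum]
    refine Finset.sum_le_sum fun q _ => ?_
    have hq := multiCoef_pos q
    calc multiCoef q * (inner ℂ (r (y q)) ((1 - A 0) (r (y q)))).re
        ≤ multiCoef q * ‖y q‖ ^ 2 := mul_le_mul_of_nonneg_left (hdef _) hq.le
      _ = 4⁻¹ * ((multiCoef q)⁻¹ * ‖η q‖ ^ 2) := by
        rw [norm_smul, Complex.norm_real, mul_pow, Real.norm_eq_abs, sq_abs]
        field_simp
        ring
  change s ≤ _
  linarith [h (r ξ) fun q => r (y q), hdef ξ]

theorem isCaratheodory_of_realPart_symCalculus_le_one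
    (hA : ∀ r : ℝ, 0 ≤ r → r < 1 →
      Summable fun k => r ^ k * colNorm (multiIdx n k) multiCoef⁻¹ A)
    (hA0 : 0 ≤ A 0)
    (hre : ∀ r : ℝ, 0 ≤ r → r < 1 →
      (ℜ (symCalculus A fun i => (r : ℂ) • leftCreation (n := n) i) :
        HTensor (Fock n) H →L[ℂ] HTensor (Fock n) H) ≤ 1) :
    IsCaratheodory A where
  zero_le := hA0
  le_one := by
    refine (le_iff_forall_re_inner_le hA0.isSelfAdjoint (.one _)).2 fun x => ?_
    simpa [inner_sub_right] using sum_re_inner_le hA hre le_rfl x 0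
  colNorm_conj_le _ hr hrA _ hk :=
    colNorm_conj_le_two hA0.isSelfAdjoint (sum_re_inner_le hA hre hk) hr hrA

end Coefficients

section PowerSeries

variable {n : ℕ}

theorem card_multiIdx_le (n k : ℕ) : (multiIdx n k).card ≤ (k + 1) ^ n := by
  have hsub : multiIdx n k ⊆ Fintype.piFinset fun _ : Fin n => Finset.range (k + 1) :=
    fun p hp => Fintype.mem_piFinset.2 fun i => Finset.mem_range_succ_iff.2 <|
      (Finset.single_le_sum (fun j _ => Nat.zero_le (p j)) (Finset.mem_univ i)).trans_eq
        (mem_multiIdx.1 hp)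
  simpa using Finset.card_le_card hsub

theorem pow_mul_factorial_le (m q : ℕ) : m ^ q * m ! ≤ m ^ m * q ! := by
  rcases le_total q m with h | h
  · calc m ^ q * m ! = m ^ q * (q ! * m.descFactorial (m - q)) := by
          rw [← Nat.factorial_mul_descFactorial (Nat.sub_le m q), Nat.sub_sub_self h]
      _ ≤ m ^ q * (q ! * m ^ (m - q)) := by gcongr; exact Nat.descFactorial_le_pow _ _
      _ = m ^ m * q ! := by rw [mul_left_comm, ← pow_add, Nat.add_sub_cancel' h, mul_comm]
  · calc m ^ q * m ! = m ^ m * (m ! * m ^ (q - m)) := by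
          rw [mul_left_comm, ← pow_add, Nat.add_sub_cancel' h, mul_comm]
      _ ≤ m ^ m * q ! := by gcongr; exact Nat.factorial_mul_pow_sub_le_factorial h

/-- The term of index `p` is the largest one in the multinomial expansion of
`(p₁ + ⋯ + pₙ)^{|p|}`. -/
theorem multinomial_mul_prod_pow_le {p q : Fin n → ℕ} (h : ∑ i, q i = ∑ i, p i) :
    Nat.multinomial Finset.univ q * ∏ i, p i ^ q i ≤
      Nat.multinomial Finset.univ p * ∏ i, p i ^ p i := by
  have hpos : 0 < (∏ i, (q i)!) * ∏ i, (p i)! :=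
    Nat.mul_pos (Finset.prod_pos fun i _ => (q i).factorial_pos)
      (Finset.prod_pos fun i _ => (p i).factorial_pos)
  have hprod : (∏ i, p i ^ q i) * ∏ i, (p i)! ≤ (∏ i, p i ^ p i) * ∏ i, (q i)! := by
    rw [← Finset.prod_mul_distrib, ← Finset.prod_mul_distrib]
    exact Finset.prod_le_prod' fun i _ => pow_mul_factorial_le (p i) (q i)
  refine Nat.le_of_mul_le_mul_left ?_ hpos
  calc (∏ i, (q i)!) * (∏ i, (p i)!) * (Nat.multinomial Finset.univ q * ∏ i, p i ^ q i)
      = (∏ i, (q i)!) * Nat.multinomial Finset.univ q *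
          ((∏ i, p i ^ q i) * ∏ i, (p i)!) := by ring
    _ ≤ (∏ i, (q i)!) * Nat.multinomial Finset.univ q *
          ((∏ i, p i ^ p i) * ∏ i, (q i)!) := by gcongr
    _ = (∏ i, (p i)!) * Nat.multinomial Finset.univ p *
          ((∏ i, p i ^ p i) * ∏ i, (q i)!) := by
        rw [Nat.multinomial_spec, Nat.multinomial_spec, h]
    _ = _ := by ring

theorem pow_self_le_multiCoef_mul_prod (p : Fin n → ℕ) {k : ℕ} (hp : p ∈ multiIdx n k) :
    (k : ℝ) ^ k ≤ (k + 1) ^ n * multiCoef p * ∏ i, (p i : ℝ) ^ p i := by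
  have hk := mem_multiIdx.1 hp
  have hnat : k ^ k ≤ (k + 1) ^ n * (Nat.multinomial Finset.univ p * ∏ i, p i ^ p i) := by
    calc k ^ k = ∑ q ∈ multiIdx n k, Nat.multinomial Finset.univ q * ∏ i, p i ^ q i := by
          conv_lhs => rw [← hk]
          rw [Finset.sum_pow_eq_sum_piAntidiag, hk]
          rfl
      _ ≤ (multiIdx n k).card • (Nat.multinomial Finset.univ p * ∏ i, p i ^ p i) :=
          Finset.sum_le_card_nsmul _ _ _ fun q hq =>
            multinomial_mul_prod_pow_le ((mem_multiIdx.1 hq).trans hk.symm)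
      _ ≤ _ := Nat.mul_le_mul_right _ (card_multiIdx_le n k)
  rw [multiCoef_eq_multinomial, mul_assoc]
  exact_mod_cast hnat

theorem hasSum_monomialAt_zero {V : Type*} [NormedAddCommGroup V] [NormedSpace ℂ V]
    (a : (Fin n → ℕ) → V) :
    HasSum (fun p => monomialAt (0 : EuclideanSpace ℂ (Fin n)) p • a p) (a 0) := by
  have hne : ∀ p ≠ 0, monomialAt (0 : EuclideanSpace ℂ (Fin n)) p = 0 := fun p hp => by
    obtain ⟨i, hi⟩ := Function.ne_iff.1 hp
    exact Finset.prod_eq_zero (Finset.mem_univ i) (zero_pow hi)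
  have hzero : monomialAt (0 : EuclideanSpace ℂ (Fin n)) 0 • a 0 = a 0 := by simp [monomialAt]
  rw [← hzero]
  exact hasSum_single 0 fun p hp => by rw [hne p hp, zero_smul]

theorem norm_monomialAt (z : EuclideanSpace ℂ (Fin n)) (p : Fin n → ℕ) :
    ‖monomialAt z p‖ = ∏ i, ‖z i‖ ^ p i := by
  simp only [monomialAt, norm_prod, norm_pow]

section Cauchy

variable {V : Type*} [NormedAddCommGroup V] [NormedSpace ℂ V] {a : (Fin n → ℕ) → V}

theorem exists_eventually_norm_monomialAt_smul_le
    (h : ∀ z ∈ Metric.ball (0 : EuclideanSpace ℂ (Fin n)) 1, Summable fun p => monomialAt z p • a p)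
    {z : EuclideanSpace ℂ (Fin n)} (hz : ‖z‖ < 1) :
    ∃ M, ∀ᶠ w in nhds z, ∀ p, ‖monomialAt w p • a p‖ ≤ M := by
  set y : ℝ → EuclideanSpace ℂ (Fin n) := fun ε => WithLp.toLp 2 fun i => ((‖z i‖ + ε : ℝ) : ℂ)
  have hy0 : ‖y 0‖ < 1 := by
    simpa only [y, EuclideanSpace.norm_eq, Complex.norm_real, add_zero, norm_norm] using hz
  have hycont : Continuous fun ε => ‖y ε‖ := by fun_prop
  have hsmall : ∀ᶠ ε in nhdsWithin (0 : ℝ) (Set.Ioi 0), ‖y ε‖ < 1 :=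
    ((hycont.tendsto 0).eventually_lt_const hy0).filter_mono nhdsWithin_le_nhds
  obtain ⟨ε, hyε, hε⟩ := (hsmall.and self_mem_nhdsWithin).exists
  obtain ⟨M, hM⟩ :=
    (h (y ε) (by simpa using hyε)).tendsto_cofinite_zero.norm.bddAbove_range_of_cofinite
  refine ⟨M, ?_⟩
  have hnear : ∀ᶠ w in nhds z, ∀ i, ‖w i‖ < ‖z i‖ + ε := eventually_all.2 fun i =>
    (Continuous.tendsto (by fun_prop) z).eventually_lt_const (lt_add_of_pos_right _ hε)
  filter_upwards [hnear] with w hw p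
  refine le_trans ?_ (hM ⟨p, rfl⟩)
  simp only [norm_smul, norm_monomialAt]
  gcongr with i
  simpa only [y, Complex.norm_real] using (hw i).le.trans (Real.le_norm_self _)

theorem exists_forall_norm_monomialAt_smul_le
    (h : ∀ z ∈ Metric.ball (0 : EuclideanSpace ℂ (Fin n)) 1, Summable fun p => monomialAt z p • a p)
    {ρ : ℝ} (hρ : ρ < 1) :
    ∃ M, ∀ z ∈ Metric.closedBall (0 : EuclideanSpace ℂ (Fin n)) ρ,
      ∀ p, ‖monomialAt z p • a p‖ ≤ M := by
  refine (isCompact_closedBall (0 : EuclideanSpace ℂ (Fin n)) ρ).induction_on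
    (p := fun s => ∃ M, ∀ z ∈ s, ∀ p, ‖monomialAt z p • a p‖ ≤ M) ⟨0, by simp⟩
    (fun s t hst ⟨M, hM⟩ => ⟨M, fun z hz => hM z (hst hz)⟩) ?_ fun z hz => ?_
  · rintro s t ⟨M, hM⟩ ⟨M', hM'⟩
    refine ⟨max M M', fun z hz p => ?_⟩
    rcases hz with hz | hz
    exacts [le_max_of_le_left (hM z hz p), le_max_of_le_right (hM' z hz p)]
  · obtain ⟨M, hM⟩ := exists_eventually_norm_monomialAt_smul_le h
      ((mem_closedBall_zero_iff.1 hz).trans_lt hρ)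
    exact ⟨_, mem_nhdsWithin_of_mem_nhds hM, M, fun _ hw => hw⟩

/-- The Cauchy estimates at the point of the sphere of radius `ρ` where `|λ^p|` is largest. -/
theorem pow_mul_norm_sq_le_of_forall_norm_monomialAt_smul_le {ρ M : ℝ} (hρ : 0 ≤ ρ)
    (hM : ∀ z ∈ Metric.closedBall (0 : EuclideanSpace ℂ (Fin n)) ρ,
      ∀ p, ‖monomialAt z p • a p‖ ≤ M) {k : ℕ} {p : Fin n → ℕ} (hp : p ∈ multiIdx n k) :
    (ρ ^ k) ^ 2 * ((multiCoef p)⁻¹ * ‖a p‖ ^ 2) ≤ M ^ 2 * (k + 1) ^ n := by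
  have hk := mem_multiIdx.1 hp
  set z : EuclideanSpace ℂ (Fin n) := WithLp.toLp 2 fun i => ((ρ * √(p i / k) : ℝ) : ℂ)
  have hzi : ∀ i, ‖z i‖ ^ 2 = ρ ^ 2 * (p i / k) := fun i => by
    rw [Complex.norm_real, Real.norm_eq_abs, sq_abs, mul_pow, Real.sq_sqrt (by positivity)]
  have hz : z ∈ Metric.closedBall (0 : EuclideanSpace ℂ (Fin n)) ρ := by
    rw [mem_closedBall_zero_iff, EuclideanSpace.norm_eq, Real.sqrt_le_left hρ]
    simp only [hzi, ← Finset.mul_sum, ← Finset.sum_div, ← Nat.cast_sum, hk]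
    exact mul_le_of_le_one_right (sq_nonneg ρ) (div_self_le_one _)
  have hmono : ‖monomialAt z p‖ ^ 2 = (ρ ^ k) ^ 2 * ((∏ i, (p i : ℝ) ^ p i) / k ^ k) := by
    rw [norm_monomialAt, ← Finset.prod_pow]
    simp only [← pow_mul, mul_comm _ 2]
    simp only [pow_mul, hzi, mul_pow, div_pow, Finset.prod_mul_distrib, Finset.prod_div_distrib,
      Finset.prod_pow_eq_pow_sum, hk]
  have hkk : (0 : ℝ) < k ^ k := by exact_mod_cast Nat.pow_self_pos
  have hcauchy : ‖monomialAt z p‖ ^ 2 * ‖a p‖ ^ 2 ≤ M ^ 2 := by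
    rw [← mul_pow, ← norm_smul]
    exact pow_le_pow_left₀ (norm_nonneg _) (hM z hz p) 2
  have hmax : (multiCoef p)⁻¹ ≤ (k + 1) ^ n * ((∏ i, (p i : ℝ) ^ p i) / k ^ k) := by
    rw [inv_le_iff_one_le_mul₀' (multiCoef_pos p), ← mul_div_assoc, ← mul_div_assoc, one_le_div hkk]
    exact (pow_self_le_multiCoef_mul_prod p hp).trans_eq (by ring)
  calc (ρ ^ k) ^ 2 * ((multiCoef p)⁻¹ * ‖a p‖ ^ 2)
      ≤ (ρ ^ k) ^ 2 * ((k + 1) ^ n * ((∏ i, (p i : ℝ) ^ p i) / k ^ k) * ‖a p‖ ^ 2) := by gcongr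
    _ = ‖monomialAt z p‖ ^ 2 * ‖a p‖ ^ 2 * (k + 1) ^ n := by rw [hmono]; ring
    _ ≤ M ^ 2 * (k + 1) ^ n := by gcongr

end Cauchy

theorem summable_pow_mul_colNorm {L : Type*} [CStarAlgebra L] {A : (Fin n → ℕ) → L}
    (hA : ∀ z ∈ Metric.ball (0 : EuclideanSpace ℂ (Fin n)) 1,
      Summable fun p => monomialAt z p • A p) {r : ℝ} (hr0 : 0 ≤ r) (hr1 : r < 1) :
    Summable fun k => r ^ k * colNorm (multiIdx n k) multiCoef⁻¹ A := by
  obtain ⟨ρ, hrρ, hρ1⟩ := exists_between hr1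
  have hρ0 : 0 < ρ := hr0.trans_lt hrρ
  obtain ⟨M, hM⟩ := exists_forall_norm_monomialAt_smul_le hA hρ1
  have hM0 : 0 ≤ M := (norm_nonneg _).trans (hM 0 (by simpa using hρ0.le) 0)
  have hcol : ∀ k : ℕ, ρ ^ k * colNorm (multiIdx n k) multiCoef⁻¹ A ≤ M * (k + 1) ^ n := fun k => by
    refine le_of_sq_le_sq ?_ (by positivity)
    calc (ρ ^ k * colNorm (multiIdx n k) multiCoef⁻¹ A) ^ 2
        ≤ ∑ p ∈ multiIdx n k, (ρ ^ k) ^ 2 * ((multiCoef p)⁻¹ * ‖A p‖ ^ 2) := by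
          rw [mul_pow, ← Finset.mul_sum]
          gcongr
          exact sq_colNorm_le_sum _ inv_multiCoef_nonneg A
      _ ≤ (multiIdx n k).card • (M ^ 2 * (k + 1) ^ n) := Finset.sum_le_card_nsmul _ _ _ fun p hp =>
          pow_mul_norm_sq_le_of_forall_norm_monomialAt_smul_le hρ0.le hM hp
      _ ≤ (k + 1) ^ n * (M ^ 2 * (k + 1) ^ n) := by
          rw [nsmul_eq_mul]
          gcongr
          exact_mod_cast card_multiIdx_le n k
      _ = (M * (k + 1) ^ n) ^ 2 := by ring
  have hratio : ‖r / ρ‖ < 1 := by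
    rwa [Real.norm_of_nonneg (by positivity), div_lt_one hρ0]
  refine .of_nonneg_of_le (fun k => mul_nonneg (pow_nonneg hr0 k) (colNorm_nonneg _ _ _))
    (fun k => ?_) (((summable_pow_mul_geometric_of_norm_lt_one n hratio).add
      (summable_geometric_of_norm_lt_one hratio)).mul_left (M * 2 ^ (n - 1)))
  calc r ^ k * colNorm (multiIdx n k) multiCoef⁻¹ A
      = (r / ρ) ^ k * (ρ ^ k * colNorm (multiIdx n k) multiCoef⁻¹ A) := by
        rw [div_pow]; field_simp
    _ ≤ (r / ρ) ^ k * (M * (2 ^ (n - 1) * ((k : ℝ) ^ n + 1 ^ n))) := by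
        refine mul_le_mul_of_nonneg_left ((hcol k).trans ?_) (by positivity)
        exact mul_le_mul_of_nonneg_left (add_pow_le k.cast_nonneg zero_le_one n) hM0
    _ = M * 2 ^ (n - 1) * ((k : ℝ) ^ n * (r / ρ) ^ k + (r / ρ) ^ k) := by ring

end PowerSeries

section HilbertSpace

variable {n : ℕ}

theorem colNorm_multiIdx_zero {L : Type*} [CStarAlgebra L] (A : (Fin n → ℕ) → L) :
    colNorm (multiIdx n 0) multiCoef⁻¹ A = ‖A 0‖ := by
  rw [colNorm, multiIdx_zero, Finset.sum_singleton, Pi.inv_apply, multiCoef_zero, inv_one,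
    one_smul, CStarRing.norm_star_mul_self, Real.sqrt_mul_self (norm_nonneg _)]

theorem IsCaratheodory.bohr_sum_colNorm_le {M : Type*} [CStarAlgebra M] [PartialOrder M]
    [StarOrderedRing M] {A : (Fin n → ℕ) → M} (hA : IsCaratheodory A) {r : ℝ} (hr0 : 0 ≤ r)
    (hr : r ≤ 1 / 3) :
    Summable (fun k => r ^ k * colNorm (multiIdx n k) multiCoef⁻¹ A) ∧
      ∑' k, r ^ k * colNorm (multiIdx n k) multiCoef⁻¹ A ≤ ‖A 0‖ + ‖1 - A 0‖ := by
  rw [← colNorm_multiIdx_zero A]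
  exact bohr_sum_le (fun _ => colNorm_nonneg _ _ _) (fun _ => hA.colNorm_le) hr0 hr

theorem tuplePow_algebraMap {L : Type*} [CStarAlgebra L] (z : EuclideanSpace ℂ (Fin n))
    (p : Fin n → ℕ) : tuplePow (fun i => algebraMap ℂ L (z i)) p = monomialAt z p • (1 : L) := by
  rw [← map_tuplePow, tuplePow, List.prod_ofFn, ← Algebra.algebraMap_eq_smul_one, monomialAt]

theorem colNorm_star_algebraMap_le {L : Type*} [CStarAlgebra L] [PartialOrder L]
    [StarOrderedRing L] (z : EuclideanSpace ℂ (Fin n)) :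
    colNorm Finset.univ 1 (fun i => star (algebraMap ℂ L (z i))) ≤ ‖z‖ := by
  have hone : ‖(1 : L)‖ ≤ 1 := by
    simpa using (norm_le_iff_le_smul_one (zero_le_one' L) zero_le_one).2 (by simp)
  refine le_of_sq_le_sq ((sq_colNorm_le_sum _ (fun _ => zero_le_one) _).trans ?_) (norm_nonneg z)
  rw [EuclideanSpace.norm_sq_eq]
  refine Finset.sum_le_sum fun i _ => ?_
  rw [one_mul, norm_star, norm_algebraMap]
  gcongr
  exact mul_le_of_le_one_right (norm_nonneg _) hone

variable {H K : Type*} [NormedAddCommGroup H] [InnerProductSpace ℂ H] [CompleteSpace H]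
  [NormedAddCommGroup K] [InnerProductSpace ℂ K] [CompleteSpace K]
  {A : (Fin n → ℕ) → H →L[ℂ] H}

theorem IsCaratheodory.norm_tsum_opTensor_tuplePow_le_one (hA : IsCaratheodory A)
    {E G : Type*} [NormedAddCommGroup E] [InnerProductSpace ℂ E] [CompleteSpace E]
    [NormedAddCommGroup G] [InnerProductSpace ℂ G] [CompleteSpace G] {X : Fin n → E →L[ℂ] E}
    (hX : ∀ i j, Commute (X i) (X j)) (hX1 : colNorm Finset.univ 1 (fun i => star (X i)) ≤ 1)
    {π : (H →L[ℂ] H) →⋆ₐ[ℂ] (G →L[ℂ] G)} {ψ : (K →L[ℂ] K) →⋆ₐ[ℂ] (G →L[ℂ] G)}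
    (hψπ : ∀ b a, Commute (ψ b) (π a)) {Y : (Fin n → ℕ) → K →L[ℂ] K} (hY0 : ‖Y 0‖ ≤ 1)
    (hYs : Summable fun k => colNorm (multiIdx n (k + 1)) multiCoef Y)
    (hY : ∑' k, colNorm (multiIdx n (k + 1)) multiCoef Y ≤ 1 / 2) :
    Summable (fun k => ∑ p ∈ multiIdx n k, opTensor (tuplePow X p) (π (A p) * ψ (Y p))) ∧
      ‖∑' k, ∑ p ∈ multiIdx n k, opTensor (tuplePow X p) (π (A p) * ψ (Y p))‖ ≤ 1 := by
  have hZ : ∀ i j, Commute (leftTensor E G (X i)) (leftTensor E G (X j)) := fun i j =>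
    (hX i j).map (leftTensor E G)
  have hZ1 : colNorm Finset.univ 1 (fun i => star (leftTensor E G (X i))) ≤ 1 := by
    simp only [← map_star]
    exact (colNorm_map_le _ _ _ _).trans hX1
  simp only [opTensor_eq_mul, map_mul, map_tuplePow, ← mul_assoc]
  exact ⟨summable_sum_tuplePow_mul_map_mul_map (π := (rightTensor E G).comp π)
      (ψ := (rightTensor E G).comp ψ) hA hZ hZ1 hYs,
    norm_tsum_tuplePow_mul_map_mul_map_le_one (π := (rightTensor E G).comp π)
      (ψ := (rightTensor E G).comp ψ) hA hZ hZ1 (fun _ _ => commute_leftTensor_rightTensor _ _)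
      (fun b a => (hψπ b a).map (rightTensor E G)) hY0 hYs hY⟩

theorem IsCaratheodory.norm_tsum_monomialAt_smul_opTensor_le_one (hA : IsCaratheodory A)
    {z : EuclideanSpace ℂ (Fin n)} (hz : ‖z‖ ≤ 1) {Y : (Fin n → ℕ) → K →L[ℂ] K}
    (hY0 : ‖Y 0‖ ≤ 1) (hYs : Summable fun k => colNorm (multiIdx n (k + 1)) multiCoef Y)
    (hY : ∑' k, colNorm (multiIdx n (k + 1)) multiCoef Y ≤ 1 / 2) :
    Summable (fun k => ∑ p ∈ multiIdx n k, monomialAt z p • opTensor (A p) (Y p)) ∧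
      ‖∑' k, ∑ p ∈ multiIdx n k, monomialAt z p • opTensor (A p) (Y p)‖ ≤ 1 := by
  set Z : Fin n → HTensor H K →L[ℂ] HTensor H K := fun i => algebraMap ℂ _ (z i)
  have hZ : ∀ i j, Commute (Z i) (Z j) := fun i j => Algebra.commutes _ _
  have hZ1 : colNorm Finset.univ 1 (fun i => star (Z i)) ≤ 1 :=
    (colNorm_star_algebraMap_le z).trans hz
  have hterm : ∀ p, monomialAt z p • opTensor (A p) (Y p) =
      tuplePow Z p * leftTensor H K (A p) * rightTensor H K (Y p) := fun p => by
    rw [opTensor_eq_mul, tuplePow_algebraMap, mul_assoc, smul_one_mul]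
  simp only [hterm]
  exact ⟨summable_sum_tuplePow_mul_map_mul_map hA hZ hZ1 hYs,
    norm_tsum_tuplePow_mul_map_mul_map_le_one hA hZ hZ1 (fun _ _ => Algebra.commutes _ _)
      (fun _ _ => (commute_leftTensor_rightTensor _ _).symm) hY0 hYs hY⟩

theorem IsCaratheodory.norm_tsum_symCreation_opTensor_le_one (hA : IsCaratheodory A)
    {Y : (Fin n → ℕ) → K →L[ℂ] K}
    (hY0 : ‖Y 0‖ ≤ 1) (hYs : Summable fun k => colNorm (multiIdx n (k + 1)) multiCoef Y)
    (hY : ∑' k, colNorm (multiIdx n (k + 1)) multiCoef Y ≤ 1 / 2) :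
    Summable (fun k => ∑ p ∈ multiIdx n k,
        opTensor (tuplePow symCreation p) (opTensor (A p) (Y p))) ∧
      ‖∑' k, ∑ p ∈ multiIdx n k,
        opTensor (tuplePow symCreation p) (opTensor (A p) (Y p))‖ ≤ 1 := by
  simp only [opTensor_eq_mul (A _)]
  exact hA.norm_tsum_opTensor_tuplePow_le_one commute_symCreation colNorm_star_symCreation_le_one
    (fun _ _ => (commute_leftTensor_rightTensor _ _).symm) hY0 hYs hY

theorem IsCaratheodory.norm_tsum_symCreation_opTensor_tuplePow_le_one (hA : IsCaratheodory A)
    {Y : Fin n → K →L[ℂ] K} (hcomm : ∀ i j, Commute (Y i) (Y j))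
    (hrow : ‖rowOp fun i => star (Y i)‖ ≤ 1 / 3) :
    Summable (fun k => ∑ p ∈ multiIdx n k,
        opTensor (tuplePow symCreation p) (opTensor (tuplePow Y p) (A p))) ∧
      ‖∑' k, ∑ p ∈ multiIdx n k,
        opTensor (tuplePow symCreation p) (opTensor (tuplePow Y p) (A p))‖ ≤ 1 := by
  have hle : ∀ k, colNorm (multiIdx n (k + 1)) multiCoef (tuplePow Y) ≤ (1 / 3) ^ (k + 1) :=
    fun k => colNorm_tuplePow_le hcomm (by norm_num)
      ((colNorm_le_norm_rowOp_star Y).trans hrow) (k + 1)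
  have hgeom : HasSum (fun k : ℕ => (1 / 3 : ℝ) ^ (k + 1)) (1 / 2) := by
    have h := (hasSum_geometric_of_lt_one (r := (1 / 3 : ℝ)) (by norm_num)
      (by norm_num)).mul_left (1 / 3)
    simp only [← pow_succ'] at h
    rwa [show (1 / 3 : ℝ) * (1 - 1 / 3)⁻¹ = 1 / 2 by norm_num] at h
  have hs : Summable fun k => colNorm (multiIdx n (k + 1)) multiCoef (tuplePow Y) :=
    .of_nonneg_of_le (fun _ => colNorm_nonneg _ _ _) hle hgeom.summable
  have hY0 : ‖tuplePow Y 0‖ ≤ 1 := by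
    rw [tuplePow_zero]
    exact ContinuousLinearMap.norm_id_le
  simp only [opTensor_eq_mul (tuplePow Y _), (commute_leftTensor_rightTensor _ _).eq]
  exact hA.norm_tsum_opTensor_tuplePow_le_one commute_symCreation colNorm_star_symCreation_le_one
    commute_leftTensor_rightTensor hY0 hs (hasSum_le hle hs.hasSum hgeom)

theorem norm_sum_opTensor_tuplePow_le {T : Fin n → K →L[ℂ] K} {c : ℝ}
    (hT : ∀ i j, Commute (T i) (T j)) (hTc : √‖∑ i, T i * star (T i)‖ ≤ c)
    (A : (Fin n → ℕ) → H →L[ℂ] H) (k : ℕ) :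
    ‖∑ p ∈ multiIdx n k, opTensor (tuplePow T p) (A p)‖ ≤
      c ^ k * colNorm (multiIdx n k) multiCoef⁻¹ A := by
  have hrow : colNorm Finset.univ 1 (fun i => star (T i)) ≤ c := by
    simpa only [colNorm, star_star, Pi.one_apply, one_smul] using hTc
  exact (norm_sum_opTensor_le multiCoef_pos _ _).trans (mul_le_mul_of_nonneg_right
    (colNorm_star_tuplePow_le hT ((colNorm_nonneg _ _ _).trans hrow) hrow k) (colNorm_nonneg _ _ _))

theorem IsCaratheodory.tsum_norm_opTensor_tuplePow_le (hA : IsCaratheodory A)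
    {T : Fin n → K →L[ℂ] K} (hT : ∀ i j, Commute (T i) (T j))
    (hT1 : √‖∑ i, T i * star (T i)‖ ≤ 1 / 3) :
    Summable (fun k => ‖∑ p ∈ multiIdx n k, opTensor (tuplePow T p) (A p)‖) ∧
      ∑' k, ‖∑ p ∈ multiIdx n k, opTensor (tuplePow T p) (A p)‖ ≤ ‖A 0‖ + ‖1 - A 0‖ := by
  have hle := norm_sum_opTensor_tuplePow_le hT hT1 A
  obtain ⟨hs, hbohr⟩ := hA.bohr_sum_colNorm_le (by norm_num) le_rfl
  have hsum := Summable.of_nonneg_of_le (fun _ => norm_nonneg _) hle hs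
  exact ⟨hsum, (hsum.tsum_le_tsum hle hs).trans hbohr⟩

end HilbertSpace

end BohrFock

end

theorem theorem4p1_general {n : ℕ}
    {H : Type*} [NormedAddCommGroup H] [InnerProductSpace ℂ H] [CompleteSpace H]
    (A : (Fin n → ℕ) → H →L[ℂ] H) (f : EuclideanSpace ℂ (Fin n) → H →L[ℂ] H)
    (hf : ∀ z ∈ Metric.ball (0 : EuclideanSpace ℂ (Fin n)) 1,
      HasSum (fun p : Fin n → ℕ => monomialAt z p • A p) (f z))
    (hf0 : 0 ≤ f 0)
    (hre : ∀ r : ℝ, 0 ≤ r → r < 1 →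
      (ℜ (symCalculus A fun i => (r : ℂ) • leftCreation (n := n) i) :
        HTensor (Fock n) H →L[ℂ] HTensor (Fock n) H) ≤ 1) :
    (∀ k : ℕ, 1 ≤ k → colNorm (multiIdx n k) multiCoef⁻¹ A ≤ 2 * ‖1 - A 0‖) ∧
    (∀ r : ℝ, 0 ≤ r → r ≤ 1 / 3 →
      Summable (fun k : ℕ => r ^ k * colNorm (multiIdx n k) multiCoef⁻¹ A) ∧
      ∑' k : ℕ, r ^ k * colNorm (multiIdx n k) multiCoef⁻¹ A ≤ ‖A 0‖ + ‖1 - A 0‖) ∧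
    (∀ (K : Type*) [NormedAddCommGroup K] [InnerProductSpace ℂ K] [CompleteSpace K]
      (Y : (Fin n → ℕ) → K →L[ℂ] K),
      ‖Y 0‖ ≤ 1 →
      Summable (fun k : ℕ => colNorm (multiIdx n (k + 1)) multiCoef Y) →
      ∑' k : ℕ, colNorm (multiIdx n (k + 1)) multiCoef Y ≤ 1 / 2 →
      (Summable (fun k : ℕ => ∑ p ∈ multiIdx n k,
          opTensor (tuplePow symCreation p) (opTensor (A p) (Y p))) ∧
        ‖∑' k : ℕ, ∑ p ∈ multiIdx n k,
          opTensor (tuplePow symCreation p) (opTensor (A p) (Y p))‖ ≤ 1) ∧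
      ∀ z ∈ Metric.ball (0 : EuclideanSpace ℂ (Fin n)) 1,
        Summable (fun k : ℕ => ∑ p ∈ multiIdx n k, monomialAt z p • opTensor (A p) (Y p)) ∧
        ‖∑' k : ℕ, ∑ p ∈ multiIdx n k, monomialAt z p • opTensor (A p) (Y p)‖ ≤ 1) ∧
    (∀ (K : Type*) [NormedAddCommGroup K] [InnerProductSpace ℂ K] [CompleteSpace K]
      (Y : Fin n → K →L[ℂ] K),
      (∀ i j, Commute (Y i) (Y j)) →
      ‖rowOp fun i => star (Y i)‖ ≤ 1 / 3 →
      Summable (fun k : ℕ => ∑ p ∈ multiIdx n k,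
        opTensor (tuplePow symCreation p) (opTensor (tuplePow Y p) (A p))) ∧
      ‖∑' k : ℕ, ∑ p ∈ multiIdx n k,
        opTensor (tuplePow symCreation p) (opTensor (tuplePow Y p) (A p))‖ ≤ 1) ∧
    (∀ (K : Type*) [NormedAddCommGroup K] [InnerProductSpace ℂ K] [CompleteSpace K]
      (T : Fin n → K →L[ℂ] K),
      (∀ i j, Commute (T i) (T j)) →
      √‖∑ i, T i * star (T i)‖ ≤ 1 / 3 →
      Summable (fun k : ℕ => ‖∑ p ∈ multiIdx n k, opTensor (tuplePow T p) (A p)‖) ∧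
      ∑' k : ℕ, ‖∑ p ∈ multiIdx n k, opTensor (tuplePow T p) (A p)‖ ≤ ‖A 0‖ + ‖1 - A 0‖) := by
  have hA0 : 0 ≤ A 0 :=
    (hf 0 (Metric.mem_ball_self one_pos)).unique (hasSum_monomialAt_zero A) ▸ hf0
  have hA : IsCaratheodory A := isCaratheodory_of_realPart_symCalculus_le_one
    (fun r hr0 hr1 => summable_pow_mul_colNorm (fun z hz => (hf z hz).summable) hr0 hr1) hA0 hre
  exact ⟨fun k hk => hA.colNorm_le hk,
    fun r hr0 hr => hA.bohr_sum_colNorm_le hr0 hr,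
    fun K _ _ _ Y hY0 hYs hY => ⟨hA.norm_tsum_symCreation_opTensor_le_one hY0 hYs hY,
      fun z hz => hA.norm_tsum_monomialAt_smul_opTensor_le_one (mem_ball_zero_iff.1 hz).le
        hY0 hYs hY⟩,
    fun K _ _ _ Y hY hrow => hA.norm_tsum_symCreation_opTensor_tuplePow_le_one hY hrow,
    fun K _ _ _ T hT hT1 => hA.tsum_norm_opTensor_tuplePow_le hT hT1⟩

theorem theorem4p1 {n : ℕ} (hn : 1 ≤ n)
    {H : Type*} [NormedAddCommGroup H] [InnerProductSpace ℂ H] [CompleteSpace H]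
    (A : (Fin n → ℕ) → H →L[ℂ] H) (f : EuclideanSpace ℂ (Fin n) → H →L[ℂ] H)
    (hf : ∀ z ∈ Metric.ball (0 : EuclideanSpace ℂ (Fin n)) 1,
      HasSum (fun p : Fin n → ℕ => monomialAt z p • A p) (f z))
    (hsup : limsup (fun k : ℕ =>
      ‖∑ p ∈ multiIdx n k, multiCoef p • (star (A p) * A p)‖ₑ ^ (1 / (2 * (k : ℝ)))) atTop ≤ 1)
    (hf0 : 0 ≤ f 0)
    (hre : ∀ r : ℝ, 0 ≤ r → r < 1 →
      (ℜ (symCalculus A fun i => (r : ℂ) • leftCreation (n := n) i) :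
        HTensor (Fock n) H →L[ℂ] HTensor (Fock n) H) ≤ 1) :
    -- (i)
    (∀ k : ℕ, 1 ≤ k →
      √‖∑ p ∈ multiIdx n k, (multiCoef p)⁻¹ • (star (A p) * A p)‖ ≤ 2 * ‖1 - A 0‖) ∧
    -- (ii)
    (∀ r : ℝ, 0 ≤ r → r ≤ 1 / 3 →
      Summable (fun k : ℕ =>
        r ^ k * √‖∑ p ∈ multiIdx n k, (multiCoef p)⁻¹ • (star (A p) * A p)‖) ∧
      ∑' k : ℕ, r ^ k * √‖∑ p ∈ multiIdx n k, (multiCoef p)⁻¹ • (star (A p) * A p)‖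
        ≤ ‖A 0‖ + ‖1 - A 0‖) ∧
    -- (iii)
    (∀ (K : Type*) [NormedAddCommGroup K] [InnerProductSpace ℂ K] [CompleteSpace K]
      (Y : (Fin n → ℕ) → K →L[ℂ] K),
      ‖Y 0‖ ≤ 1 →
      Summable (fun k : ℕ =>
        √‖∑ p ∈ multiIdx n (k + 1), multiCoef p • (star (Y p) * Y p)‖) →
      ∑' k : ℕ, √‖∑ p ∈ multiIdx n (k + 1), multiCoef p • (star (Y p) * Y p)‖ ≤ 1 / 2 →
      (Summable (fun k : ℕ => ∑ p ∈ multiIdx n k,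
          opTensor (tuplePow symCreation p) (opTensor (A p) (Y p))) ∧
        ‖∑' k : ℕ, ∑ p ∈ multiIdx n k,
          opTensor (tuplePow symCreation p) (opTensor (A p) (Y p))‖ ≤ 1) ∧
      ∀ z ∈ Metric.ball (0 : EuclideanSpace ℂ (Fin n)) 1,
        Summable (fun k : ℕ => ∑ p ∈ multiIdx n k, monomialAt z p • opTensor (A p) (Y p)) ∧
        ‖∑' k : ℕ, ∑ p ∈ multiIdx n k, monomialAt z p • opTensor (A p) (Y p)‖ ≤ 1) ∧
    -- (iv)
    (∀ (K : Type*) [NormedAddCommGroup K] [InnerProductSpace ℂ K] [CompleteSpace K]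
      (Y : Fin n → K →L[ℂ] K),
      (∀ i j, Commute (Y i) (Y j)) →
      ‖rowOp fun i => star (Y i)‖ ≤ 1 / 3 →
      Summable (fun k : ℕ => ∑ p ∈ multiIdx n k,
        opTensor (tuplePow symCreation p) (opTensor (tuplePow Y p) (A p))) ∧
      ‖∑' k : ℕ, ∑ p ∈ multiIdx n k,
        opTensor (tuplePow symCreation p) (opTensor (tuplePow Y p) (A p))‖ ≤ 1) ∧
    -- (v)
    (∀ (K : Type*) [NormedAddCommGroup K] [InnerProductSpace ℂ K] [CompleteSpace K]
      (T : Fin n → K →L[ℂ] K),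
      (∀ i j, Commute (T i) (T j)) →
      √‖∑ i, T i * star (T i)‖ ≤ 1 / 3 →
      Summable (fun k : ℕ => ‖∑ p ∈ multiIdx n k, opTensor (tuplePow T p) (A p)‖) ∧
      ∑' k : ℕ, ‖∑ p ∈ multiIdx n k, opTensor (tuplePow T p) (A p)‖ ≤ ‖A 0‖ + ‖1 - A 0‖) :=
  theorem4p1_general A f hf hf0 hre
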